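/- **Conventions.** Let $\mathbb K\in\{\mathbb R,\mathbb C\}$; locally compact spaces and groups are Hausdorff. Let $G$ be a locally compact group acting continuously on a locally compact space $\Omega$, $\varphi_g(x)=gx$, and let $S\subset G$ be a closed submonoid. Let $\mathrm C_0(\Omega)$ be the algebra of continuous $\mathbb K$-valued functions on $\Omega$ vanishing at infinity, and $T_\varphi(g)f=f\circ\varphi_{g^{-1}}$ for $g\in G$, $f\in \mathrm C_0(\Omega)$. **Bundles.** A *Banach bundle* over $\Omega$ is a topological space $E$ with a continuous open surjection $p_E\colon E\to\Omega$ whose fibers $E_x=p_E^{-1}(x)$ are Banach spaces over $\mathbb K$, such that addition $E\times_\Omega E\to E$ and scalar multiplication $\mathbb K\times E\to E$ are continuous, the norm $E\to[0,\infty)$ is upper semicontinuous, and for every $x\in\Omega$ and every open $W\ni 0_x$ there are $\varepsilon>0$ and an open neighborhood $U$ of $x$ with $\{v\in p_E^{-1}(U): \|v\|\le\varepsilon\}\subset W$. For a continuous map $\psi\colon \Omega\to\Omega$, a *morphism* $E\to F$ over $\psi$ is a continuous map $\Phi\colon E\to F$ with $p_F\circ\Phi=\psi\circ p_E$ that is bounded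 and linear on each fiber, with $\|\Phi\|=\sup_x\|\Phi|_{E_x}\|<\infty$. An *$S$-dynamical Banach bundle* $(E;\Phi)$ over $(\Omega;\varphi)$ is a Banach bundle $E$ over $\Omega$ with morphisms $\Phi_g\colon E\to E$ over $\varphi_g$ ($g\in S$) such that $\Phi_1=\mathrm{id}_E$, $\Phi_{gh}=\Phi_g\circ\Phi_h$, the map $S\times E\to E$, $(g,v)\mapsto\Phi_gv$, is continuous, and $\sup_{g\in K}\|\Phi_g\|<\infty$ for every compact $K\subset S$. A morphism $(E;\Phi)\to(F;\Psi)$ is a morphism $\Theta\colon E\to F$ over $\mathrm{id}_\Omega$ with $\Theta\circ\Phi_g=\Psi_g\circ\Theta$ for all $g\in S$. **Modules.** A *Banach module* over $\mathrm C_0(\Omega)$ is a Banach space $\Gamma$ over $\mathbb K$ with a bilinear $\mathrm C_0(\Omega)$-module operation satisfying $\|fs\|\le\|f\|\|s\|$ and $\overline{\mathrm{lin}}\{fs : f\in \mathrm C_0(\Omega),\, s\in\Gamma\}=\Gamma$. For $s\in\Gamma$, the submodule $\Gamma_s=\overline{\mathrm C_0(\Omega)s}$ is a Banach lattice (for $\mathbb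 K=\mathbb C$, a complex one) with positive cone $\overline{\{fs: f\in \mathrm C_0(\Omega),\, f\ge 0\}}$. The module $\Gamma$ is an *AM-module* if each $\Gamma_s$ is an AM-space, that is, $\|t\vee u\|=\max(\|t\|,\|u\|)$ for all positive $t,u\in\Gamma_s$. An *$S$-dynamical AM-module* $(\Gamma;\mathcal T)$ over $(\mathrm C_0(\Omega);T_\varphi)$ is an AM-module $\Gamma$ with bounded operators $\mathcal T(g)$ on $\Gamma$ ($g\in S$) such that $\mathcal T(1)=\mathrm{Id}$, $\mathcal T(gh)=\mathcal T(g)\mathcal T(h)$, $\mathcal T(g)(fs)=(T_\varphi(g)f)\cdot\mathcal T(g)s$, and $g\mapsto\mathcal T(g)s$ is continuous on $S$ for every $s\in\Gamma$. Its homomorphisms are the bounded $\mathrm C_0(\Omega)$-linear operators that intertwine the operators of the dynamics. **The assignments.** For a Banach bundle $E$ let $\Gamma_0(E)$ be the space of continuous sections $s$ of $E$ vanishing at infinity (for every $\varepsilon>0$ there is a compact $K\subset\Omega$ with $\|s(x)\|\le\varepsilon$ for $x\notin K$), with pointwise operations and $\|s\|=\sup_x\|s(x)\|$. Put $\mathcal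 T_\Phi(g)s=\Phi_g\circ s\circ\varphi_{g^{-1}}$ for an $S$-dynamical Banach bundle $(E;\Phi)$ and $V_\Theta s=\Theta\circ s$ for a morphism $\Theta$. **Theorem.** The assignments $$(E;\Phi)\mapsto(\Gamma_0(E);\mathcal T_\Phi),\qquad \Theta\mapsto V_\Theta$$ define a functor from the category of $S$-dynamical Banach bundles over $(\Omega;\varphi)$ to the category of $S$-dynamical AM-modules over $(\mathrm C_0(\Omega);T_\varphi)$, and this functor is essentially surjective and fully faithful. -/

import Mathlib

open CategoryTheory Topology
open scoped ZeroAtInfty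

universe u v k w

/-- A (topological) Banach bundle over `Ω`. The bundle space is the disjoint union
`Bundle.TotalSpace PUnit fiber` of the fibres `fiber x` (`PUnit` is a dummy argument), with a
topology which is part of the data. -/
structure BanachBundle (𝕜 : Type k) [RCLike 𝕜] (Ω : Type u) [TopologicalSpace Ω] where
  /-- the fibres -/
  fiber : Ω → Type v
  [normedAddCommGroup : ∀ x, NormedAddCommGroup (fiber x)]
  [normedSpace : ∀ x, NormedSpace 𝕜 (fiber x)]
  [completeSpace : ∀ x, CompleteSpace (fiber x)]
  /-- the topology of the bundle space -/
  [topology : TopologicalSpace (Bundle.TotalSpace PUnit.{1} fiber)]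
  continuous_proj :
    Continuous (Bundle.TotalSpace.proj : Bundle.TotalSpace PUnit.{1} fiber → Ω)
  isOpenMap_proj :
    IsOpenMap (Bundle.TotalSpace.proj : Bundle.TotalSpace PUnit.{1} fiber → Ω)
  /-- addition is continuous on `E ×_Ω E`, with the subspace topology from `E × E` -/
  continuous_add : Continuous
    (fun q : {q : Bundle.TotalSpace PUnit.{1} fiber × Bundle.TotalSpace PUnit.{1} fiber //
        q.1.proj = q.2.proj} =>
      (⟨q.1.2.proj, (q.2 ▸ q.1.1.snd : fiber q.1.2.proj) + q.1.2.snd⟩ :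
        Bundle.TotalSpace PUnit.{1} fiber))
  continuous_smul : Continuous
    (fun q : 𝕜 × Bundle.TotalSpace PUnit.{1} fiber =>
      (⟨q.2.proj, q.1 • q.2.snd⟩ : Bundle.TotalSpace PUnit.{1} fiber))
  upperSemicontinuous_norm :
    UpperSemicontinuous (fun v : Bundle.TotalSpace PUnit.{1} fiber => ‖v.snd‖)
  zero_nhds : ∀ (x : Ω) (W : Set (Bundle.TotalSpace PUnit.{1} fiber)), IsOpen W →
    (⟨x, 0⟩ : Bundle.TotalSpace PUnit.{1} fiber) ∈ W →
    ∃ ε > (0 : ℝ), ∃ U : Set Ω, IsOpen U ∧ x ∈ U ∧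
      ∀ v : Bundle.TotalSpace PUnit.{1} fiber, v.proj ∈ U → ‖v.snd‖ ≤ ε → v ∈ W

attribute [instance] BanachBundle.normedAddCommGroup BanachBundle.normedSpace
  BanachBundle.completeSpace BanachBundle.topology

namespace BanachBundle

variable {𝕜 : Type k} [RCLike 𝕜] {Ω : Type u} [TopologicalSpace Ω]

/-- The bundle space. -/
abbrev Total (E : BanachBundle.{u, v} 𝕜 Ω) : Type (max u v) :=
  Bundle.TotalSpace PUnit.{1} E.fiber

/-- A family of vectors in the fibres is a continuous section. -/
def IsContSection (E : BanachBundle.{u, v} 𝕜 Ω) (s : ∀ x, E.fiber x) : Prop :=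
  Continuous (fun x => (⟨x, s x⟩ : E.Total))

/-- A family of vectors in the fibres vanishes at infinity. -/
def VanishesAtInfty (E : BanachBundle.{u, v} 𝕜 Ω) (s : ∀ x, E.fiber x) : Prop :=
  ∀ ε > (0 : ℝ), ∃ K : Set Ω, IsCompact K ∧ ∀ x, x ∉ K → ‖s x‖ ≤ ε

theorem isContSection_zero (E : BanachBundle.{u, v} 𝕜 Ω) :
    E.IsContSection (fun _ => 0) := by
  refine continuous_iff_continuousAt.2 fun x => ?_
  intro N hN
  obtain ⟨W, hWN, hW, hxW⟩ := mem_nhds_iff.1 hN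
  obtain ⟨ε, hε, U, hU, hxU, h⟩ := E.zero_nhds x W hW hxW
  refine Filter.mem_map.2
    (Filter.mem_of_superset (hU.mem_nhds hxU) fun y hy => hWN (h ⟨y, 0⟩ hy ?_))
  exact (norm_zero (E := E.fiber y)).trans_le hε.le

theorem continuous_add_of {E : BanachBundle.{u, v} 𝕜 Ω} {X : Type*} [TopologicalSpace X]
    {b : X → Ω} {s t : ∀ x, E.fiber (b x)}
    (hs : Continuous (fun x => (⟨b x, s x⟩ : E.Total)))
    (ht : Continuous (fun x => (⟨b x, t x⟩ : E.Total))) :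
    Continuous (fun x => (⟨b x, s x + t x⟩ : E.Total)) :=
  E.continuous_add.comp
    (f := fun x => ⟨((⟨b x, s x⟩ : E.Total), (⟨b x, t x⟩ : E.Total)), rfl⟩)
    ((hs.prodMk ht).subtype_mk _)

theorem continuous_smul_of {E : BanachBundle.{u, v} 𝕜 Ω} {X : Type*} [TopologicalSpace X]
    {b : X → Ω} {c : X → 𝕜} {s : ∀ x, E.fiber (b x)} (hc : Continuous c)
    (hs : Continuous (fun x => (⟨b x, s x⟩ : E.Total))) :
    Continuous (fun x => (⟨b x, c x • s x⟩ : E.Total)) :=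
  E.continuous_smul.comp (f := fun x => (c x, (⟨b x, s x⟩ : E.Total))) (hc.prodMk hs)

/-- The continuous sections vanishing at infinity, as a linear subspace of the product of the
fibres. -/
def sectionSubmodule (E : BanachBundle.{u, v} 𝕜 Ω) : Submodule 𝕜 (∀ x, E.fiber x) where
  carrier := {s | E.IsContSection s ∧ E.VanishesAtInfty s}
  zero_mem' := ⟨E.isContSection_zero, fun ε hε => ⟨∅, isCompact_empty, fun x _ => by
    simpa using hε.le⟩⟩
  add_mem' := by
    rintro s t ⟨hs, hs'⟩ ⟨ht, ht'⟩
    refine ⟨continuous_add_of hs ht, fun ε hε => ?_⟩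
    obtain ⟨K, hK, h⟩ := hs' (ε / 2) (half_pos hε)
    obtain ⟨L, hL, h'⟩ := ht' (ε / 2) (half_pos hε)
    refine ⟨K ∪ L, hK.union hL, fun x hx => ?_⟩
    have h1 := h x fun hx' => hx (Or.inl hx')
    have h2 := h' x fun hx' => hx (Or.inr hx')
    exact (norm_add_le _ _).trans (by linarith)
  smul_mem' := by
    rintro c s ⟨hs, hs'⟩
    refine ⟨continuous_smul_of continuous_const hs, fun ε hε => ?_⟩
    obtain ⟨K, hK, h⟩ := hs' (ε / (‖c‖ + 1)) (by positivity)
    refine ⟨K, hK, fun x hx => ?_⟩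
    have h1 := h x hx
    rw [Pi.smul_apply, norm_smul]
    rw [le_div_iff₀ (by positivity)] at h1
    nlinarith [norm_nonneg (s x), norm_nonneg c]

/-- The space `Γ₀(E)` of continuous sections of `E` vanishing at infinity. -/
def Section0 (E : BanachBundle.{u, v} 𝕜 Ω) : Type (max u v) := ↥E.sectionSubmodule

namespace Section0

variable {E : BanachBundle.{u, v} 𝕜 Ω}

instance : AddCommGroup E.Section0 := inferInstanceAs (AddCommGroup ↥E.sectionSubmodule)

instance : Module 𝕜 E.Section0 := inferInstanceAs (Module 𝕜 ↥E.sectionSubmodule)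

instance : CoeFun E.Section0 (fun _ => ∀ x, E.fiber x) := ⟨fun s => s.1⟩

@[ext]
theorem ext {s t : E.Section0} (h : ∀ x, s x = t x) : s = t := Subtype.ext (funext h)

@[simp] theorem zero_apply (x : Ω) : (0 : E.Section0) x = 0 := rfl

@[simp] theorem add_apply (s t : E.Section0) (x : Ω) : (s + t) x = s x + t x := rfl

@[simp] theorem smul_apply (c : 𝕜) (s : E.Section0) (x : Ω) : (c • s) x = c • s x := rfl

theorem continuous (s : E.Section0) : Continuous (fun x => (⟨x, s x⟩ : E.Total)) := s.2.1

theorem vanishes (s : E.Section0) : E.VanishesAtInfty s := s.2.2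

theorem bddAbove (s : E.Section0) : BddAbove (Set.range fun x => ‖s x‖) := by
  obtain ⟨K, hK, h⟩ := s.vanishes 1 one_pos
  have husc : UpperSemicontinuous (fun x => ‖s x‖) :=
    E.upperSemicontinuous_norm.comp s.continuous
  obtain ⟨C, hC⟩ := (husc.upperSemicontinuousOn K).bddAbove_of_isCompact hK
  refine ⟨max C 1, ?_⟩
  rintro _ ⟨x, rfl⟩
  by_cases hx : x ∈ K
  · exact le_max_of_le_left (hC ⟨x, hx, rfl⟩)
  · exact le_max_of_le_right (h x hx)

/-- The supremum norm. -/
noncomputable instance : Norm E.Section0 := ⟨fun s => ⨆ x, ‖s x‖⟩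

theorem norm_def (s : E.Section0) : ‖s‖ = ⨆ x, ‖s x‖ := rfl

theorem norm_apply_le (s : E.Section0) (x : Ω) : ‖s x‖ ≤ ‖s‖ := le_ciSup s.bddAbove x

theorem norm_nonneg' (s : E.Section0) : 0 ≤ ‖s‖ := Real.iSup_nonneg fun _ => norm_nonneg _

theorem norm_le_of {s : E.Section0} {C : ℝ} (hC : 0 ≤ C) (h : ∀ x, ‖s x‖ ≤ C) : ‖s‖ ≤ C :=
  Real.iSup_le h hC

theorem core : NormedSpace.Core 𝕜 E.Section0 where
  norm_nonneg := norm_nonneg'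
  norm_smul c s := by
    simp only [norm_def, smul_apply, norm_smul]
    rw [Real.mul_iSup_of_nonneg (norm_nonneg c)]
  norm_triangle s t := norm_le_of (add_nonneg s.norm_nonneg' t.norm_nonneg') fun x =>
    (norm_add_le _ _).trans (add_le_add (s.norm_apply_le x) (t.norm_apply_le x))
  norm_eq_zero_iff s := by
    refine ⟨fun h => ext fun x => ?_, ?_⟩
    · have := s.norm_apply_le x
      rw [h] at this
      simpa using this
    · rintro rfl
      simp [norm_def]

noncomputable instance : NormedAddCommGroup E.Section0 := NormedAddCommGroup.ofCore (𝕜 := 𝕜) core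

noncomputable instance : NormedSpace 𝕜 E.Section0 := NormedSpace.ofCore core

/-- The product `f s`, `x ↦ f x • s x`, of `f ∈ C₀(Ω)` and `s ∈ Γ₀(E)`. -/
def mulBy (f : C₀(Ω, 𝕜)) (s : E.Section0) : E.Section0 :=
  ⟨fun x => f x • s x, continuous_smul_of (map_continuous f) s.continuous, fun ε hε => by
    have hb : Filter.Tendsto (fun x => ‖f x‖ * ‖s‖) (Filter.cocompact Ω) (𝓝 0) := by
      simpa using (f.zero_at_infty'.norm).mul_const ‖s‖
    obtain ⟨K, hK, hKs⟩ := Filter.mem_cocompact.1 (hb.eventually (ge_mem_nhds hε))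
    refine ⟨K, hK, fun x hx => ?_⟩
    rw [norm_smul]
    exact (mul_le_mul_of_nonneg_left (s.norm_apply_le x) (norm_nonneg _)).trans (hKs hx)⟩

/-- The operation of `C₀(Ω)` on `Γ₀(E)` as a bilinear map. -/
def act (E : BanachBundle.{u, v} 𝕜 Ω) : C₀(Ω, 𝕜) →ₗ[𝕜] E.Section0 →ₗ[𝕜] E.Section0 :=
  LinearMap.mk₂ 𝕜 mulBy
    (fun _ _ _ => ext fun _ => add_smul _ _ _)
    (fun _ _ _ => ext fun _ => mul_smul _ _ _)
    (fun _ _ _ => ext fun _ => smul_add _ _ _)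
    (fun _ _ _ => ext fun _ => smul_comm _ _ _)

@[simp] theorem act_apply (f : C₀(Ω, 𝕜)) (s : E.Section0) (x : Ω) :
    act E f s x = f x • s x := rfl

end Section0

/-- A (bounded) Banach bundle morphism `E → F` over `φ : Ω → Ω`. The fibrewise operators
`E_x → F_{φ x}` determine the map `onTotal` between the bundle spaces. -/
structure Morphism (φ : Ω → Ω) (E F : BanachBundle.{u, v} 𝕜 Ω) where
  /-- the operators on the fibres -/
  app : ∀ x, E.fiber x →L[𝕜] F.fiber (φ x)
  continuous_total : Continuous (fun v : E.Total => (⟨φ v.proj, app v.proj v.snd⟩ : F.Total))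
  bounded : ∃ C : ℝ, ∀ x, ‖app x‖ ≤ C

namespace Morphism

variable {E F H : BanachBundle.{u, v} 𝕜 Ω} {φ : Ω → Ω}

/-- The map between the bundle spaces. -/
def onTotal (Φ : Morphism φ E F) (v : E.Total) : F.Total := ⟨φ v.proj, Φ.app v.proj v.snd⟩

@[ext]
theorem ext {Φ Ψ : Morphism φ E F} (h : ∀ x v, Φ.app x v = Ψ.app x v) : Φ = Ψ := by
  cases Φ
  cases Ψ
  congr
  funext x
  exact ContinuousLinearMap.ext (h x)

theorem exists_bound (Φ : Morphism φ E F) :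
    ∃ C : ℝ, 0 ≤ C ∧ ∀ x v, ‖Φ.app x v‖ ≤ C * ‖v‖ := by
  obtain ⟨C, hC⟩ := Φ.bounded
  refine ⟨max C 0, le_max_right _ _, fun x v => ?_⟩
  exact (Φ.app x).le_of_opNorm_le ((hC x).trans (le_max_left _ _)) v

/-- The identity, a morphism over `id`. -/
def refl (E : BanachBundle.{u, v} 𝕜 Ω) : Morphism id E E where
  app x := ContinuousLinearMap.id 𝕜 (E.fiber x)
  continuous_total := continuous_id
  bounded := ⟨1, fun _ => ContinuousLinearMap.norm_id_le⟩

/-- The composition of morphisms over `id`. -/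
def trans (Θ : Morphism id E F) (Ξ : Morphism id F H) : Morphism id E H where
  app x := (Ξ.app x).comp (Θ.app x)
  continuous_total := Ξ.continuous_total.comp Θ.continuous_total
  bounded := by
    obtain ⟨C, hC⟩ := Θ.bounded
    obtain ⟨D, hD⟩ := Ξ.bounded
    refine ⟨|D| * |C|, fun x => (ContinuousLinearMap.opNorm_comp_le _ _).trans ?_⟩
    exact mul_le_mul ((hD x).trans (le_abs_self D)) ((hC x).trans (le_abs_self C))
      (norm_nonneg _) (abs_nonneg D)

/-- The section `Θ ∘ s`. -/
def compSection (Θ : Morphism id E F) (s : E.Section0) : F.Section0 :=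
  ⟨fun x => Θ.app x (s x), Θ.continuous_total.comp s.continuous, fun ε hε => by
    obtain ⟨C, hC0, hC⟩ := Θ.exists_bound
    obtain ⟨K, hK, h⟩ := s.vanishes (ε / (C + 1)) (by positivity)
    refine ⟨K, hK, fun x hx => (hC x _).trans ?_⟩
    have h1 := h x hx
    rw [le_div_iff₀ (by positivity)] at h1
    nlinarith [norm_nonneg (s x)]⟩

/-- The operator `V_Θ : Γ₀(E) → Γ₀(F)`, `s ↦ Θ ∘ s`. -/
noncomputable def sectionMap (Θ : Morphism id E F) : E.Section0 →L[𝕜] F.Section0 :=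
  LinearMap.mkContinuousOfExistsBound
    { toFun := Θ.compSection
      map_add' := fun s t => Section0.ext fun x => map_add (Θ.app x) (s x) (t x)
      map_smul' := fun c s => Section0.ext fun x => map_smul (Θ.app x) c (s x) }
    (by
      obtain ⟨C, hC0, hC⟩ := Θ.exists_bound
      exact ⟨C, fun s => Section0.norm_le_of (mul_nonneg hC0 (norm_nonneg _)) fun x =>
        (hC x _).trans (mul_le_mul_of_nonneg_left (s.norm_apply_le x) hC0)⟩)

@[simp] theorem sectionMap_apply (Θ : Morphism id E F) (s : E.Section0) (x : Ω) :
    Θ.sectionMap s x = Θ.app x (s x) := rfl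

end Morphism

/-- The identification of the fibres over equal points. -/
def fiberCast (E : BanachBundle.{u, v} 𝕜 Ω) {x y : Ω} (h : x = y) :
    E.fiber x ≃ₗᵢ[𝕜] E.fiber y :=
  h ▸ LinearIsometryEquiv.refl 𝕜 (E.fiber x)

theorem mk_fiberCast (E : BanachBundle.{u, v} 𝕜 Ω) {x y : Ω} (h : x = y) (v : E.fiber x) :
    (⟨y, E.fiberCast h v⟩ : E.Total) = ⟨x, v⟩ := by
  subst h
  rfl

/-- The section `Φ ∘ s ∘ φ⁻¹` for a morphism `Φ` over a homeomorphism `φ`. -/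
def Morphism.conjSection {E F : BanachBundle.{u, v} 𝕜 Ω} (φ : Ω ≃ₜ Ω) (Φ : Morphism φ E F)
    (s : E.Section0) : F.Section0 :=
  ⟨fun x => F.fiberCast (φ.apply_symm_apply x) (Φ.app (φ.symm x) (s (φ.symm x))), by
    have h : Continuous (fun x => Φ.onTotal ⟨φ.symm x, s (φ.symm x)⟩) :=
      Φ.continuous_total.comp (s.continuous.comp φ.symm.continuous)
    refine h.congr fun x => ?_
    exact (F.mk_fiberCast (φ.apply_symm_apply x) _).symm, fun ε hε => by
    obtain ⟨C, hC0, hC⟩ := Φ.exists_bound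
    obtain ⟨K, hK, h⟩ := s.vanishes (ε / (C + 1)) (by positivity)
    refine ⟨φ '' K, hK.image φ.continuous, fun x hx => ?_⟩
    rw [LinearIsometryEquiv.norm_map]
    refine (hC _ _).trans ?_
    have h1 := h (φ.symm x) fun hx' => hx ⟨_, hx', φ.apply_symm_apply x⟩
    rw [le_div_iff₀ (by positivity)] at h1
    nlinarith [norm_nonneg (s (φ.symm x))]⟩

/-- The weighted Koopman operator `Γ₀(E) → Γ₀(F)`, `s ↦ Φ ∘ s ∘ φ⁻¹`, of a morphism `Φ` over a
homeomorphism `φ`. -/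
noncomputable def Morphism.weightedKoopman {E F : BanachBundle.{u, v} 𝕜 Ω} (φ : Ω ≃ₜ Ω)
    (Φ : Morphism φ E F) : E.Section0 →L[𝕜] F.Section0 :=
  LinearMap.mkContinuousOfExistsBound
    { toFun := Φ.conjSection φ
      map_add' := fun s t => Section0.ext fun x =>
        (congrArg (F.fiberCast (φ.apply_symm_apply x)) (map_add (Φ.app _) _ _)).trans
          (map_add _ _ _)
      map_smul' := fun c s => Section0.ext fun x =>
        (congrArg (F.fiberCast (φ.apply_symm_apply x)) (map_smul (Φ.app _) _ _)).trans
          (map_smul (F.fiberCast (φ.apply_symm_apply x)) _ _) }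
    (by
      obtain ⟨C, hC0, hC⟩ := Φ.exists_bound
      refine ⟨C, fun s => Section0.norm_le_of (mul_nonneg hC0 (norm_nonneg _)) fun x => ?_⟩
      refine (LinearIsometryEquiv.norm_map _ _).le.trans ((hC _ _).trans ?_)
      exact mul_le_mul_of_nonneg_left (s.norm_apply_le _) hC0)

theorem Morphism.mk_weightedKoopman_apply {E F : BanachBundle.{u, v} 𝕜 Ω} (φ : Ω ≃ₜ Ω)
    (Φ : Morphism φ E F) (s : E.Section0) (x : Ω) :
    (⟨x, Φ.weightedKoopman φ s x⟩ : F.Total) = Φ.onTotal ⟨φ.symm x, s (φ.symm x)⟩ :=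
  F.mk_fiberCast (φ.apply_symm_apply x) _

end BanachBundle

section Dynamics

variable (𝕜 : Type k) [RCLike 𝕜] (Ω : Type u) [TopologicalSpace Ω]
  {G : Type w} [Group G] [TopologicalSpace G] [MulAction G Ω] [ContinuousConstSMul G Ω]
  (S : Submonoid G)

/-- The Koopman operator `T_φ(g) f = f ∘ φ_{g⁻¹}` on `C₀(Ω)`. -/
def koopman (g : G) (f : C₀(Ω, 𝕜)) : C₀(Ω, 𝕜) :=
  f.comp (Homeomorph.smul g⁻¹ : Ω ≃ₜ Ω).toCocompactMap

/-- An `S`-dynamical Banach bundle over the system given by the action of `G` on `Ω`. -/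
structure DynBundle where
  /-- the bundle -/
  bundle : BanachBundle.{u, v} 𝕜 Ω
  /-- the morphism `Φ_g` over `x ↦ g x`, for `g ∈ S` -/
  dyn : ∀ g : S, BanachBundle.Morphism (Homeomorph.smul (g : G) : Ω ≃ₜ Ω) bundle bundle
  dyn_one : (dyn 1).onTotal = id
  dyn_mul : ∀ g h : S, (dyn (g * h)).onTotal = (dyn g).onTotal ∘ (dyn h).onTotal
  jointly_continuous : Continuous (fun q : S × bundle.Total => (dyn q.1).onTotal q.2)
  locally_bounded : ∀ K : Set S, IsCompact K → ∃ C : ℝ, ∀ g ∈ K, ∀ x, ‖(dyn g).app x‖ ≤ C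

/-- A Banach space with an operation of `C₀(Ω)` (a bilinear map) and bounded operators indexed by
`S`: the data of an `S`-dynamical Banach module. The axioms are in `IsDynAMModule`. -/
structure PreDynModule where
  /-- the underlying space -/
  carrier : Type v
  [normedAddCommGroup : NormedAddCommGroup carrier]
  [normedSpace : NormedSpace 𝕜 carrier]
  /-- the product `f s` -/
  act : C₀(Ω, 𝕜) →ₗ[𝕜] carrier →ₗ[𝕜] carrier
  /-- the operators of the dynamics -/
  op : S → (carrier →L[𝕜] carrier)

attribute [instance] PreDynModule.normedAddCommGroup PreDynModule.normedSpace

variable {𝕜 Ω S}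

namespace DynBundle

/-- A morphism of `S`-dynamical Banach bundles: a Banach bundle morphism (over the identity) which
intertwines the dynamics. -/
@[ext]
structure Hom (E F : DynBundle.{u, v} 𝕜 Ω S) where
  /-- the underlying bundle morphism -/
  toMorphism : BanachBundle.Morphism id E.bundle F.bundle
  intertwines : ∀ (g : S) (v : E.bundle.Total),
    toMorphism.onTotal ((E.dyn g).onTotal v) = (F.dyn g).onTotal (toMorphism.onTotal v)

instance : Category (DynBundle.{u, v} 𝕜 Ω S) where
  Hom := Hom
  id E := ⟨BanachBundle.Morphism.refl E.bundle, fun _ _ => rfl⟩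
  comp Θ Ξ := ⟨Θ.toMorphism.trans Ξ.toMorphism, fun g v => by
    have h1 := Θ.intertwines g v
    have h2 := Ξ.intertwines g (Θ.toMorphism.onTotal v)
    exact (congrArg Ξ.toMorphism.onTotal h1).trans h2⟩

end DynBundle

namespace PreDynModule

/-- A homomorphism: a bounded operator which is `C₀(Ω)`-linear and intertwines the dynamics. -/
@[ext]
structure Hom (M N : PreDynModule.{u, v} 𝕜 Ω S) where
  /-- the underlying bounded operator -/
  toCLM : M.carrier →L[𝕜] N.carrier
  map_act : ∀ (f : C₀(Ω, 𝕜)) (s : M.carrier), toCLM (M.act f s) = N.act f (toCLM s)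
  intertwines : ∀ (g : S) (s : M.carrier), toCLM (M.op g s) = N.op g (toCLM s)

instance : Category (PreDynModule.{u, v} 𝕜 Ω S) where
  Hom := Hom
  id M := ⟨ContinuousLinearMap.id 𝕜 M.carrier, fun _ _ => rfl, fun _ _ => rfl⟩
  comp V W := ⟨W.toCLM.comp V.toCLM, fun f s => by simp [V.map_act, W.map_act],
    fun g s => by simp [V.intertwines, W.intertwines]⟩

variable (M : PreDynModule.{u, v} 𝕜 Ω S)

/-- The positive cone of the cyclic submodule `Γ_s`: the closure of `{f s | f ∈ C₀(Ω), f ≥ 0}`. -/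
def cyclicCone (s : M.carrier) : Set M.carrier :=
  closure {t | ∃ f : C₀(Ω, 𝕜),
    (∀ x, 0 ≤ RCLike.re (f x) ∧ RCLike.im (f x) = 0) ∧ t = M.act f s}

/-- `w` is the supremum of `t` and `u` in `Γ_s`, for the order with positive cone `cyclicCone s`.
For `t` in the cone every upper bound of `t` lies in the cone, so that it does not matter that `z`
below ranges over the whole space. -/
def IsCyclicSup (s t u w : M.carrier) : Prop :=
  w - t ∈ M.cyclicCone s ∧ w - u ∈ M.cyclicCone s ∧
    ∀ z, z - t ∈ M.cyclicCone s → z - u ∈ M.cyclicCone s → z - w ∈ M.cyclicCone s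

/-- `Γ_s` is an AM-space: `‖t ∨ u‖ = max ‖t‖ ‖u‖` for all positive `t` and `u`. -/
def IsCyclicAMSpace (s : M.carrier) : Prop :=
  ∀ t ∈ M.cyclicCone s, ∀ u ∈ M.cyclicCone s,
    ∃ w, M.IsCyclicSup s t u w ∧ ‖w‖ = max ‖t‖ ‖u‖

/-- `M` is a non-degenerate Banach module over `C₀(Ω)`. -/
structure IsBanachModule : Prop where
  complete : CompleteSpace M.carrier
  mul_act : ∀ (f g : C₀(Ω, 𝕜)) (s : M.carrier), M.act (f * g) s = M.act f (M.act g s)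
  norm_act_le : ∀ (f : C₀(Ω, 𝕜)) (s : M.carrier), ‖M.act f s‖ ≤ ‖f‖ * ‖s‖
  nondegenerate : closure (Submodule.span 𝕜
    {t | ∃ (f : C₀(Ω, 𝕜)) (s : M.carrier), t = M.act f s} : Set M.carrier) = Set.univ

/-- `M` is an `S`-dynamical Banach module over `(C₀(Ω); T_φ)`. -/
structure IsDynamical : Prop extends M.IsBanachModule where
  op_one : M.op 1 = ContinuousLinearMap.id 𝕜 M.carrier
  op_mul : ∀ g h : S, M.op (g * h) = (M.op g).comp (M.op h)
  op_act : ∀ (g : S) (f : C₀(Ω, 𝕜)) (s : M.carrier),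
    M.op g (M.act f s) = M.act (koopman 𝕜 Ω (g : G) f) (M.op g s)
  strongly_continuous : ∀ s : M.carrier, Continuous (fun g : S => M.op g s)

/-- `M` is an `S`-dynamical AM-module over `(C₀(Ω); T_φ)`. -/
structure IsDynAMModule : Prop extends M.IsDynamical where
  am : ∀ s : M.carrier, M.IsCyclicAMSpace s

end PreDynModule

variable (𝕜 Ω S)

/-- `S`-dynamical AM-modules, as a property of objects. -/
def dynAMModule : ObjectProperty (PreDynModule.{u, v} 𝕜 Ω S) :=
  fun M => M.IsDynAMModule

/-- The category of `S`-dynamical AM-modules over `(C₀(Ω); T_φ)`, a full subcategory: the morphisms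
are all homomorphisms of `S`-dynamical Banach modules. -/
abbrev DynAMModule := (dynAMModule.{u, v} 𝕜 Ω S).FullSubcategory

/-- The assignments `(E; Φ) ↦ (Γ₀(E); 𝒯_Φ)` and `Θ ↦ V_Θ`. -/
noncomputable def sectionFunctor :
    DynBundle.{u, v} 𝕜 Ω S ⥤ PreDynModule.{u, max u v} 𝕜 Ω S where
  obj E :=
    { carrier := E.bundle.Section0
      act := BanachBundle.Section0.act E.bundle
      op := fun g => (E.dyn g).weightedKoopman (Homeomorph.smul (g : G)) }
  map {E F} Θ :=
    { toCLM := Θ.toMorphism.sectionMap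
      map_act := fun f s => BanachBundle.Section0.ext fun x =>
        map_smul (Θ.toMorphism.app x) (f x) (s x)
      intertwines := fun g s => BanachBundle.Section0.ext fun x => by
        have h1 : (⟨x, Θ.toMorphism.sectionMap
            ((E.dyn g).weightedKoopman (Homeomorph.smul (g : G)) s) x⟩ : F.bundle.Total) =
            ⟨x, (F.dyn g).weightedKoopman (Homeomorph.smul (g : G))
              (Θ.toMorphism.sectionMap s) x⟩ := by
          rw [BanachBundle.Morphism.mk_weightedKoopman_apply]
          refine Eq.trans ?_ (Θ.intertwines g
            ⟨(Homeomorph.smul (g : G) : Ω ≃ₜ Ω).symm x, s _⟩)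
          exact congrArg Θ.toMorphism.onTotal
            (BanachBundle.Morphism.mk_weightedKoopman_apply _ _ s x)
        simpa using h1 }
  map_id E := rfl
  map_comp Θ Ξ := rfl

end Dynamics

/-! The bundle is rebuilt from the module. The fibre of Γ at x is the quotient of Γ by the closed
span of all fs with f(x) = 0, so every s in Γ becomes a field of values s(x). If ‖s(x)‖ < c, then
some cutoff χ equal to 1 near x satisfies ‖χs‖ < c (`exists_cutoff_norm_act_lt`). Hence x ↦ ‖s(x)‖
is upper semicontinuous, and the tubes around these fields are the topology of a Banach bundle E.

The AM condition gives ‖s‖ = sup ‖s(x)‖ (`norm_le_of_forall_norm_ev_le`): finitely many such cutoffs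
cover a compact set outside of which s is negligible, and passing to their maximum does not increase
the norm. For this, `isCyclicAMSpace_iff` translates the lattice condition into ‖max(f,g)s‖ ≤
max(‖fs‖, ‖gs‖) for f, g ≥ 0, which is evident for a supremum norm, so that section modules are AM.
Thus Γ embeds isometrically into Γ₀(E), with closed range by completeness and dense range by
partitions of unity.

Full faithfulness rests on two facts. Every vector is the value of a section
(`Section0.exists_apply_eq`); it is obtained from discontinuous selections of small oscillation,
successively improved by partitions of unity. And a bounded C₀(Ω)-linear V satisfies ‖(Vs)(x)‖ ≤
‖V‖‖s(x)‖, by cutting s off near x, so V acts fibrewise.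

As for the dynamics, 𝒯(g) maps elements vanishing at x to elements vanishing at gx and so induces
fibre maps. Joint continuity of Φ yields strong continuity of 𝒯 by compactness; conversely, strong
continuity yields local boundedness by Banach–Steinhaus, and then joint continuity. -/

section BundleTopology

open Filter

namespace BanachBundle

variable {𝕜 : Type k} [RCLike 𝕜] {Ω : Type u} [TopologicalSpace Ω] {E : BanachBundle.{u, v} 𝕜 Ω}

/-! ### Convergence in the bundle space, oscillation, and completeness of Γ₀(E) -/

section Tendsto

variable {X : Type*} {F : Filter X} {b : X → Ω} {s t : ∀ a, E.fiber (b a)} {x : Ω}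
  {v w : E.fiber x}

theorem tendsto_proj (hs : Tendsto (fun a => (⟨b a, s a⟩ : E.Total)) F (𝓝 ⟨x, v⟩)) :
    Tendsto b F (𝓝 x) :=
  (E.continuous_proj.tendsto (⟨x, v⟩ : E.Total)).comp hs

theorem tendsto_add (hs : Tendsto (fun a => (⟨b a, s a⟩ : E.Total)) F (𝓝 ⟨x, v⟩))
    (ht : Tendsto (fun a => (⟨b a, t a⟩ : E.Total)) F (𝓝 ⟨x, w⟩)) :
    Tendsto (fun a => (⟨b a, s a + t a⟩ : E.Total)) F (𝓝 ⟨x, v + w⟩) :=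
  (E.continuous_add.tendsto ⟨((⟨x, v⟩ : E.Total), (⟨x, w⟩ : E.Total)), rfl⟩).comp
    (f := fun a => ⟨((⟨b a, s a⟩ : E.Total), (⟨b a, t a⟩ : E.Total)), rfl⟩)
    (tendsto_subtype_rng.2 (hs.prodMk_nhds ht))

theorem tendsto_smul {c : X → 𝕜} {c₀ : 𝕜} (hc : Tendsto c F (𝓝 c₀))
    (hs : Tendsto (fun a => (⟨b a, s a⟩ : E.Total)) F (𝓝 ⟨x, v⟩)) :
    Tendsto (fun a => (⟨b a, c a • s a⟩ : E.Total)) F (𝓝 ⟨x, c₀ • v⟩) :=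
  (E.continuous_smul.tendsto (c₀, (⟨x, v⟩ : E.Total))).comp
    (f := fun a => (c a, (⟨b a, s a⟩ : E.Total))) (hc.prodMk_nhds hs)

theorem tendsto_sub (hs : Tendsto (fun a => (⟨b a, s a⟩ : E.Total)) F (𝓝 ⟨x, v⟩))
    (ht : Tendsto (fun a => (⟨b a, t a⟩ : E.Total)) F (𝓝 ⟨x, w⟩)) :
    Tendsto (fun a => (⟨b a, s a - t a⟩ : E.Total)) F (𝓝 ⟨x, v - w⟩) := by
  have h := tendsto_add hs (tendsto_smul (tendsto_const_nhds (x := (-1 : 𝕜))) ht)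
  simpa only [neg_smul, one_smul, ← sub_eq_add_neg] using h

theorem eventually_norm_lt (hs : Tendsto (fun a => (⟨b a, s a⟩ : E.Total)) F (𝓝 ⟨x, v⟩))
    {r : ℝ} (hr : ‖v‖ < r) : ∀ᶠ a in F, ‖s a‖ < r :=
  hs.eventually (E.upperSemicontinuous_norm ⟨x, v⟩ r hr)

theorem tendsto_zero (hb : Tendsto b F (𝓝 x)) (hs : Tendsto (fun a => ‖s a‖) F (𝓝 0)) :
    Tendsto (fun a => (⟨b a, s a⟩ : E.Total)) F (𝓝 ⟨x, 0⟩) := by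
  intro N hN
  obtain ⟨W, hWN, hW, hxW⟩ := mem_nhds_iff.1 hN
  obtain ⟨ε, hε, U, hU, hxU, h⟩ := E.zero_nhds x W hW hxW
  rw [mem_map]
  filter_upwards [hb.eventually (hU.mem_nhds hxU), hs.eventually (ge_mem_nhds hε)] with a h1 h2
  exact hWN (h ⟨b a, s a⟩ h1 h2)

theorem tendsto_norm_zero (hs : Tendsto (fun a => (⟨b a, s a⟩ : E.Total)) F (𝓝 ⟨x, 0⟩)) :
    Tendsto (fun a => ‖s a‖) F (𝓝 0) := by
  refine tendsto_order.2 ⟨fun r hr => Eventually.of_forall fun a => hr.trans_le (norm_nonneg _),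
    fun r hr => eventually_norm_lt hs (by simpa using hr)⟩

/-- Convergence in the bundle space can be tested against a section which is continuous at the
base point. -/
theorem tendsto_iff_of_continuousAt {σ : ∀ y, E.fiber y}
    (hσ : Tendsto (fun y => (⟨y, σ y⟩ : E.Total)) (𝓝 x) (𝓝 ⟨x, σ x⟩)) :
    Tendsto (fun a => (⟨b a, s a⟩ : E.Total)) F (𝓝 ⟨x, σ x⟩) ↔
      Tendsto b F (𝓝 x) ∧ Tendsto (fun a => ‖s a - σ (b a)‖) F (𝓝 0) := by
  constructor
  · intro h
    refine ⟨tendsto_proj h, tendsto_norm_zero (x := x) ?_⟩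
    simpa only [sub_self] using tendsto_sub h (hσ.comp (tendsto_proj h))
  · rintro ⟨hb, h⟩
    have h1 := tendsto_add (hσ.comp hb) (tendsto_zero (x := x) hb h)
    simpa only [Function.comp_def, add_zero, add_sub_cancel] using h1

end Tendsto

/-- Pairs of vectors in a common fibre converging to `(v, w)`. -/
def pairFilter {x : Ω} (v w : E.fiber x) : Filter (Σ y, E.fiber y × E.fiber y) :=
  comap (fun q => (⟨q.1, q.2.1⟩ : E.Total)) (𝓝 ⟨x, v⟩) ⊓
    comap (fun q => (⟨q.1, q.2.2⟩ : E.Total)) (𝓝 ⟨x, w⟩)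

theorem tendsto_pairFilter_fst {x : Ω} (v w : E.fiber x) :
    Tendsto (fun q : Σ y, E.fiber y × E.fiber y => (⟨q.1, q.2.1⟩ : E.Total))
      (pairFilter v w) (𝓝 ⟨x, v⟩) :=
  tendsto_comap.mono_left inf_le_left

theorem tendsto_pairFilter_snd {x : Ω} (v w : E.fiber x) :
    Tendsto (fun q : Σ y, E.fiber y × E.fiber y => (⟨q.1, q.2.2⟩ : E.Total))
      (pairFilter v w) (𝓝 ⟨x, w⟩) :=
  tendsto_comap.mono_left inf_le_right

/-- As the projection is open, every vector close to `v` has a partner close to `w`. -/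
theorem eventually_exists_of_pairFilter {x : Ω} {v w : E.fiber x}
    {R : ∀ y, E.fiber y → E.fiber y → Prop}
    (h : ∀ᶠ q in pairFilter v w, R q.1 q.2.1 q.2.2) :
    ∀ᶠ a in 𝓝 (⟨x, v⟩ : E.Total), ∃ u : E.fiber a.proj, R a.proj a.snd u := by
  obtain ⟨P, ⟨A, hA, hAP⟩, Q, ⟨B, hB, hBQ⟩, hPQ⟩ := mem_inf_iff.1 h
  have hB0 : Bundle.TotalSpace.proj '' B ∈ 𝓝 x := E.isOpenMap_proj.image_mem_nhds hB
  have hB' := E.continuous_proj.tendsto (⟨x, v⟩ : E.Total) hB0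
  filter_upwards [hA, hB'] with a ha ha'
  obtain ⟨y, a⟩ := a
  obtain ⟨⟨y', u⟩, hu, rfl⟩ := ha'
  refine ⟨u, ?_⟩
  have hmem : (⟨y', a, u⟩ : Σ y, E.fiber y × E.fiber y) ∈ P ∩ Q := ⟨hAP ha, hBQ hu⟩
  rwa [← hPQ] at hmem

/-- The oscillation at `x` of a not necessarily continuous section `s` is at most `ε`. -/
def OscLE (s : ∀ x, E.fiber x) (x : Ω) (ε : ℝ) : Prop :=
  ∀ δ > ε, ∀ᶠ a : E.Total in 𝓝 ⟨x, s x⟩, ‖a.snd - s a.proj‖ < δ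

namespace OscLE

variable {s t : ∀ x, E.fiber x} {x : Ω} {ε ε' : ℝ}

theorem mono (hs : OscLE s x ε) (h : ε ≤ ε') : OscLE s x ε' := fun δ hδ => hs δ (h.trans_lt hδ)

/-- As a → s(x), the vectors s(proj a) = a + (s(proj a) − a) also tend to s(x), because the
difference tends to 0 in norm. Since the projection is open, the points proj a fill a neighbourhood
of x. -/
theorem tendsto (h : OscLE s x 0) :
    Tendsto (fun y => (⟨y, s y⟩ : E.Total)) (𝓝 x) (𝓝 ⟨x, s x⟩) := by
  have h1 : Tendsto (fun a : E.Total => ‖s a.proj - a.snd‖) (𝓝 ⟨x, s x⟩) (𝓝 0) := by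
    refine tendsto_order.2 ⟨fun r hr => Eventually.of_forall fun a => hr.trans_le (norm_nonneg _),
      fun r hr => ?_⟩
    filter_upwards [h r hr] with a ha
    rwa [norm_sub_rev]
  have h2 : Tendsto (fun a : E.Total => (⟨a.proj, a.snd⟩ : E.Total)) (𝓝 ⟨x, s x⟩)
    (𝓝 ⟨x, s x⟩) := tendsto_id
  have h3 := tendsto_add h2 (tendsto_zero (tendsto_proj h2) h1)
  simp only [add_sub_cancel, add_zero] at h3
  intro N hN
  rw [mem_map]
  have h4 := E.isOpenMap_proj.image_mem_nhds (h3 hN)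
  refine mem_of_superset (h4 : _ ∈ 𝓝 x) ?_
  rintro _ ⟨a, ha, rfl⟩
  exact ha

theorem of_tendsto (h : Tendsto (fun y => (⟨y, s y⟩ : E.Total)) (𝓝 x) (𝓝 ⟨x, s x⟩)) :
    OscLE s x 0 := by
  intro δ hδ
  have h2 : Tendsto (fun a : E.Total => (⟨a.proj, a.snd⟩ : E.Total)) (𝓝 ⟨x, s x⟩)
    (𝓝 ⟨x, s x⟩) := tendsto_id
  refine eventually_norm_lt (tendsto_sub h2 (h.comp (tendsto_proj h2))) ?_
  simpa using hδ

/-- A vector a near c(x)s(x) cannot be divided by c, which may vanish. It is compared with c(y)u for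
a partner u near s(x) in the same fibre, and only u is compared with s(y). -/
theorem smul {c : Ω → 𝕜} (hs : OscLE s x ε) (hc : ContinuousAt c x) :
    OscLE (fun y => c y • s y) x (‖c x‖ * ε) := by
  intro δ hδ
  -- The expression is the final bound. It is continuous in η and equals ‖c x‖ε < δ at η = 0.
  obtain ⟨η, hηδ, hη⟩ : ∃ η : ℝ, η + (‖c x‖ + η) * (ε + η) < δ ∧ 0 < η := by
    have h : Tendsto (fun η : ℝ => η + (‖c x‖ + η) * (ε + η)) (𝓝 0)
        (𝓝 (0 + (‖c x‖ + 0) * (ε + 0))) := by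
      apply Continuous.tendsto
      fun_prop
    have h' := (h.mono_left (nhdsWithin_le_nhds (s := Set.Ioi 0))).eventually
      (gt_mem_nhds (by simpa using hδ))
    exact (h'.and self_mem_nhdsWithin).exists
  refine eventually_exists_of_pairFilter (w := s x)
    (R := fun y a u => ‖a - c y • u‖ < η ∧ ‖u - s y‖ < ε + η ∧ ‖c y‖ < ‖c x‖ + η) ?_ |>.mono ?_
  · have h1 := tendsto_pairFilter_fst (c x • s x) (s x)
    have h2 := tendsto_pairFilter_snd (c x • s x) (s x)
    refine (eventually_norm_lt (tendsto_sub h1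
      (tendsto_smul (hc.tendsto.comp (tendsto_proj h2)) h2)) (by simpa using hη)).and
      ((h2.eventually (hs (ε + η) (by linarith))).and ?_)
    exact (hc.norm.tendsto.comp (tendsto_proj h2)).eventually
      (gt_mem_nhds (by linarith : ‖c x‖ < ‖c x‖ + η))
  · rintro a ⟨u, h1, h2, h3⟩
    have h4 : a.snd - c a.proj • s a.proj =
      (a.snd - c a.proj • u) + c a.proj • (u - s a.proj) := by rw [smul_sub]; abel
    rw [h4]
    refine (norm_add_le _ _).trans_lt (lt_trans ?_ hηδ)
    rw [norm_smul]
    refine add_lt_add_of_lt_of_le h1 (mul_le_mul h3.le h2.le (norm_nonneg _) ?_)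
    positivity

/-- A vector a near s(x) + t(x) is split by a partner u near s(x); then a − u is near t(x). -/
theorem add (hs : OscLE s x ε) (ht : OscLE t x ε') : OscLE (fun y => s y + t y) x (ε + ε') := by
  intro δ hδ
  obtain ⟨η, hη, hηδ⟩ : ∃ η : ℝ, 0 < η ∧ ε + ε' + 3 * η ≤ δ :=
    ⟨(δ - (ε + ε')) / 3, by linarith, by linarith⟩
  refine eventually_exists_of_pairFilter (w := s x)
    (R := fun y a u => ‖(a - u) - t y‖ < ε' + η ∧ ‖u - s y‖ < ε + η) ?_ |>.mono ?_
  · have h1 := tendsto_pairFilter_fst (s x + t x) (s x)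
    have h2 := tendsto_pairFilter_snd (s x + t x) (s x)
    have h3 := tendsto_sub h1 h2
    rw [add_sub_cancel_left] at h3
    exact (h3.eventually (ht (ε' + η) (by linarith))).and
      (h2.eventually (hs (ε + η) (by linarith)))
  · rintro a ⟨u, h1, h2⟩
    have h4 : a.snd - (s a.proj + t a.proj) = (a.snd - u - t a.proj) + (u - s a.proj) := by abel
    rw [h4]
    exact (norm_add_le _ _).trans_lt (by linarith)

theorem zero : OscLE (fun y => (0 : E.fiber y)) x 0 :=
  of_tendsto (E.isContSection_zero.tendsto x)

theorem congr (hs : OscLE s x ε) (h : ∀ᶠ y in 𝓝 x, t y = s y) : OscLE t x ε := by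
  intro δ hδ
  have h1 := hs δ hδ
  rw [← h.self_of_nhds] at h1
  filter_upwards [h1, (E.continuous_proj.tendsto (⟨x, t x⟩ : E.Total)).eventually h] with a h2 h3
  rwa [h3]

theorem sum {ι : Type*} (I : Finset ι) {s : ι → ∀ x, E.fiber x} {ε : ι → ℝ}
    (h : ∀ i ∈ I, OscLE (s i) x (ε i)) :
    OscLE (fun y => ∑ i ∈ I, s i y) x (∑ i ∈ I, ε i) := by
  classical
  induction I using Finset.induction_on with
  | empty => simpa using zero
  | insert i I hi ih =>
    have h1 := (h i (Finset.mem_insert_self i I)).add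
      (ih fun j hj => h j (Finset.mem_insert_of_mem hj))
    simpa only [Finset.sum_insert hi] using h1

/-- A uniform perturbation by at most `η` increases the oscillation by at most `2 * η`. -/
theorem perturb {η : ℝ} (hs : OscLE s x ε) (h : ∀ᶠ y in 𝓝 x, ‖s y - t y‖ ≤ η) :
    OscLE t x (ε + 2 * η) := by
  intro δ hδ
  obtain ⟨ρ, hρ, hρδ⟩ : ∃ ρ : ℝ, 0 < ρ ∧ ε + 2 * η + 2 * ρ ≤ δ :=
    ⟨(δ - (ε + 2 * η)) / 2, by linarith, by linarith⟩
  refine eventually_exists_of_pairFilter (w := s x)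
    (R := fun y a u => ‖u - a‖ < η + ρ ∧ ‖u - s y‖ < ε + ρ ∧ ‖s y - t y‖ ≤ η) ?_ |>.mono ?_
  · have h1 := tendsto_pairFilter_fst (t x) (s x)
    have h2 := tendsto_pairFilter_snd (t x) (s x)
    refine (eventually_norm_lt (tendsto_sub h2 h1) ?_).and
      ((h2.eventually (hs (ε + ρ) (by linarith))).and ((tendsto_proj h1).eventually h))
    exact h.self_of_nhds.trans_lt (by linarith)
  · rintro a ⟨u, h1, h2, h3⟩
    -- The perturbation enters twice: at x, through u − a near s(x) − t(x), and at the nearby point,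
    -- through the last summand.
    have h4 : a.snd - t a.proj = -(u - a.snd) + (u - s a.proj) + (s a.proj - t a.proj) := by abel
    rw [h4]
    refine (norm_add₃_le).trans_lt ?_
    rw [norm_neg]
    linarith

/-- Uniform limits of sections with small oscillation are continuous. -/
theorem of_approx (h : ∀ η > 0, ∃ s, OscLE s x η ∧ ∀ᶠ y in 𝓝 x, ‖s y - t y‖ ≤ η) :
    OscLE t x 0 := by
  intro δ hδ
  -- `perturb` triples the error, and 3δ/4 < δ.
  obtain ⟨s, hs, hst⟩ := h (δ / 4) (by linarith)
  exact hs.perturb hst δ (by linarith)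

end OscLE

theorem isContSection_iff {s : ∀ x, E.fiber x} :
    E.IsContSection s ↔ ∀ x, OscLE s x 0 :=
  ⟨fun h x => .of_tendsto (h.tendsto x), fun h => continuous_iff_continuousAt.2 fun x =>
    (h x).tendsto⟩

namespace Section0

theorem tendsto (s : E.Section0) (x : Ω) :
    Tendsto (fun y => (⟨y, s y⟩ : E.Total)) (𝓝 x) (𝓝 ⟨x, s x⟩) := s.continuous.tendsto x

@[simp] theorem sub_apply (s t : E.Section0) (x : Ω) : (s - t) x = s x - t x := rfl

@[simp] theorem sum_apply {ι : Type*} (I : Finset ι) (s : ι → E.Section0) (x : Ω) :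
    (∑ i ∈ I, s i) x = ∑ i ∈ I, s i x := by
  classical
  induction I using Finset.induction_on with
  | empty => simp
  | insert i I hi ih => simp [Finset.sum_insert hi, ih]

/-- A Cauchy sequence converges in each fibre, uniformly over Ω; the limit is continuous because
uniform approximation controls its oscillation (`OscLE.of_approx`). -/
instance : CompleteSpace E.Section0 := by
  refine Metric.complete_of_cauchySeq_tendsto fun s hs => ?_
  have hpt : ∀ x, ∃ v, Tendsto (fun n => s n x) atTop (𝓝 v) := fun x => by
    refine cauchySeq_tendsto_of_complete (Metric.cauchySeq_iff'.2 fun ε hε => ?_)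
    obtain ⟨N, hN⟩ := Metric.cauchySeq_iff'.1 hs ε hε
    refine ⟨N, fun n hn => ?_⟩
    have h := hN n hn
    rw [dist_eq_norm] at h ⊢
    exact ((s n - s N).norm_apply_le x).trans_lt h
  choose t ht using hpt
  have key : ∀ ε > 0, ∃ N, ∀ n ≥ N, ∀ x, ‖s n x - t x‖ ≤ ε := fun ε hε => by
    obtain ⟨N, hN⟩ := Metric.cauchySeq_iff.1 hs ε hε
    refine ⟨N, fun n hn x => ?_⟩
    refine le_of_tendsto ((tendsto_const_nhds.sub (ht x)).norm) ?_
    filter_upwards [eventually_ge_atTop N] with m hm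
    have h := hN n hn m hm
    rw [dist_eq_norm] at h
    exact ((s n - s m).norm_apply_le x).trans h.le
  have htc : E.IsContSection t := isContSection_iff.2 fun x => OscLE.of_approx fun η hη => by
    obtain ⟨N, hN⟩ := key η hη
    exact ⟨s N, (OscLE.of_tendsto ((s N).tendsto x)).mono hη.le, .of_forall (hN N le_rfl)⟩
  have htv : E.VanishesAtInfty t := fun ε hε => by
    obtain ⟨N, hN⟩ := key (ε / 2) (half_pos hε)
    obtain ⟨K, hK, h⟩ := (s N).vanishes (ε / 2) (half_pos hε)
    refine ⟨K, hK, fun x hx => ?_⟩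
    have h1 := hN N le_rfl x
    have h2 := h x hx
    have h3 := norm_sub_le (s N x) (s N x - t x)
    rw [sub_sub_cancel] at h3
    linarith
  let τ : E.Section0 := ⟨t, And.intro htc htv⟩
  refine ⟨τ, Metric.tendsto_atTop.2 fun ε hε => ?_⟩
  obtain ⟨N, hN⟩ := key (ε / 2) (half_pos hε)
  refine ⟨N, fun n hn => ?_⟩
  rw [dist_eq_norm (s n) τ]
  exact (norm_le_of (half_pos hε).le (hN n hn)).trans_lt (half_lt_self hε)

end Section0

end BanachBundle

end BundleTopology

/-! ### Partitions of unity and cutoff functions -/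

section Partition

open Set Filter

variable {Ω : Type u} [TopologicalSpace Ω] [T2Space Ω] [LocallyCompactSpace Ω]

theorem exists_finite_partition {K : Set Ω} (hK : IsCompact K) (V : Ω → Set Ω)
    (hV : ∀ x ∈ K, IsOpen (V x) ∧ x ∈ V x) :
    ∃ (n : ℕ) (y : Fin n → Ω) (χ : Fin n → C(Ω, ℝ)), (∀ i, y i ∈ K) ∧
      (∀ i, tsupport (χ i) ⊆ V (y i)) ∧ (∀ x ∈ K, ∑ i, χ i x = 1) ∧ (∀ i x, 0 ≤ χ i x) ∧
      ∀ i, HasCompactSupport (χ i) := by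
  obtain ⟨t, htK, ht⟩ := hK.elim_nhds_subcover V fun x hx => (hV x hx).1.mem_nhds (hV x hx).2
  obtain ⟨χ, h1, h2, h3, h4⟩ := exists_continuous_sum_one_of_isOpen_isCompact
    (s := fun i : Fin t.card => V (t.equivFin.symm i))
    (fun i => (hV _ (htK _ (t.equivFin.symm i).2)).1) hK (fun x hx => by
      obtain ⟨y, hy, hxy⟩ := mem_iUnion₂.1 (ht hx)
      exact mem_iUnion.2 ⟨t.equivFin ⟨y, hy⟩, by simpa using hxy⟩)
  refine ⟨_, fun i => t.equivFin.symm i, χ, fun i => htK _ (t.equivFin.symm i).2, h1,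
    fun x hx => ?_, fun i x => (h3 i x).1, h4⟩
  simpa using h2 hx

theorem exists_cutoff {K U : Set Ω} (hK : IsCompact K) (hU : IsOpen U) (hKU : K ⊆ U) :
    ∃ χ : C(Ω, ℝ), (∀ x ∈ K, χ x = 1) ∧ tsupport χ ⊆ U ∧ (∀ x, 0 ≤ χ x ∧ χ x ≤ 1) ∧
      HasCompactSupport χ := by
  obtain ⟨χ, h1, h2, h3, h4⟩ := exists_continuous_sum_one_of_isOpen_isCompact
    (s := fun _ : Fin 1 => U) (fun _ => hU) hK (fun x hx => mem_iUnion.2 ⟨0, hKU hx⟩)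
  exact ⟨χ 0, fun x hx => by simpa using h2 hx, h1 0, fun x => h3 0 x, h4 0⟩

end Partition

/-- Balls are convex. Only indices with nonzero weight are constrained, as suits a partition of
unity. -/
theorem norm_sum_smul_sub_le {𝕜 : Type*} [RCLike 𝕜] {V : Type*} [NormedAddCommGroup V]
    [NormedSpace 𝕜 V] {ι : Type*} [Fintype ι] {c : ι → ℝ} (hc : ∀ i, 0 ≤ c i)
    (hc1 : ∑ i, c i = 1) {w : ι → V} {v : V} {C : ℝ} (h : ∀ i, c i ≠ 0 → ‖w i - v‖ ≤ C) :
    ‖∑ i, (c i : 𝕜) • w i - v‖ ≤ C := by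
  have h1 : ∑ i, (c i : 𝕜) • w i - v = ∑ i, (c i : 𝕜) • (w i - v) := by
    simp only [smul_sub, Finset.sum_sub_distrib, ← Finset.sum_smul]
    rw [← RCLike.ofReal_sum, hc1, RCLike.ofReal_one, one_smul]
  have h2 : ∀ i ∈ Finset.univ, ‖(c i : 𝕜) • (w i - v)‖ ≤ c i * C := fun i _ => by
    rw [norm_smul, RCLike.norm_ofReal, abs_of_nonneg (hc i)]
    rcases eq_or_ne (c i) 0 with h0 | h0
    · simp [h0]
    · exact mul_le_mul_of_nonneg_left (h i h0) (hc i)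
  rw [h1]
  refine (norm_sum_le_of_le _ h2).trans ?_
  rw [← Finset.sum_mul, hc1, one_mul]

/-! ### Existence of enough continuous sections -/

section Selection

open Set Filter

namespace BanachBundle

variable {𝕜 : Type k} [RCLike 𝕜] {Ω : Type u} [TopologicalSpace Ω] {E : BanachBundle.{u, v} 𝕜 Ω}

/-- Off the closed support of χ the product vanishes near x, so nothing is needed of s there. -/
theorem OscLE.smul_tsupport {s : ∀ x, E.fiber x} {x : Ω} {ε : ℝ} {χ : C(Ω, ℝ)}
    (h : x ∈ tsupport χ → OscLE s x ε) :
    OscLE (fun y => (χ y : 𝕜) • s y) x (|χ x| * ε) := by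
  by_cases hx : x ∈ tsupport χ
  · have h1 := (h hx).smul (c := fun y => (χ y : 𝕜)) (by fun_prop)
    simpa using h1
  · have h0 := notMem_tsupport_iff_eventuallyEq.1 hx
    have h1 : OscLE (fun y => (χ y : 𝕜) • s y) x 0 := zero.congr (h0.mono fun y hy => by simp [hy])
    rwa [h0.self_of_nhds, Pi.zero_apply, abs_zero, zero_mul]

/-- By continuity of subtraction and upper semicontinuity of the norm, v has an open neighbourhood W
that is thin: two vectors of W in one fibre differ by less than ε. Any selection from W, however
discontinuous, then has oscillation at most ε over the open image of W. -/
theorem exists_local_oscLE {x : Ω} (v : E.fiber x) {ε : ℝ} (hε : 0 < ε) {R : Set E.Total}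
    (hR : R ∈ 𝓝 (⟨x, v⟩ : E.Total)) :
    ∃ (V : Set Ω) (g : ∀ y, E.fiber y), IsOpen V ∧ x ∈ V ∧ g x = v ∧
      ∀ y ∈ V, OscLE g y ε ∧ (⟨y, g y⟩ : E.Total) ∈ R := by
  have h : ∀ᶠ q in pairFilter v v, ‖q.2.1 - q.2.2‖ < ε :=
    eventually_norm_lt (tendsto_sub (tendsto_pairFilter_fst v v) (tendsto_pairFilter_snd v v))
      (by simpa using hε)
  obtain ⟨P, ⟨A, hA, hAP⟩, Q, ⟨B, hB, hBQ⟩, hPQ⟩ := mem_inf_iff.1 h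
  obtain ⟨W, hWR, hW, hvW⟩ := mem_nhds_iff.1 (inter_mem (inter_mem hA hB) hR)
  have hthin : ∀ y (a b : E.fiber y), (⟨y, a⟩ : E.Total) ∈ W → (⟨y, b⟩ : E.Total) ∈ W →
      ‖a - b‖ < ε := fun y a b ha hb => by
    have hmem : (⟨y, a, b⟩ : Σ y, E.fiber y × E.fiber y) ∈ P ∩ Q :=
      ⟨hAP (hWR ha).1.1, hBQ (hWR hb).1.2⟩
    rwa [← hPQ] at hmem
  -- The choice is arbitrary except over x, where v is forced; outside the image of W the value 0 is
  -- a dummy.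
  have hsel : ∀ y, ∃ u : E.fiber y, (y ∈ Bundle.TotalSpace.proj '' W → (⟨y, u⟩ : E.Total) ∈ W) ∧
      ∀ h : x = y, u = h ▸ v := fun y => by
    by_cases hxy : x = y
    · subst hxy
      exact ⟨v, fun _ => hvW, fun _ => rfl⟩
    · by_cases hy : y ∈ Bundle.TotalSpace.proj '' W
      · obtain ⟨⟨y', u⟩, hu, rfl⟩ := hy
        exact ⟨u, fun _ => hu, fun h => (hxy h).elim⟩
      · exact ⟨0, fun h => (hy h).elim, fun h => (hxy h).elim⟩
  choose g hg hgx using hsel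
  refine ⟨_, g, E.isOpenMap_proj W hW, ⟨_, hvW, rfl⟩, hgx x rfl,
    fun y hy => ⟨fun δ hδ => ?_, (hWR (hg y hy)).2⟩⟩
  filter_upwards [hW.mem_nhds (hg y hy)] with a ha
  exact (hthin _ _ _ ha (hg _ ⟨a, ha, rfl⟩)).trans hδ

variable [T2Space Ω] [LocallyCompactSpace Ω]

/-- Local selections through the values f(y), thin to within ε' and close to f because f has
oscillation at most ε, are averaged by a partition of unity. Convexity preserves both estimates. -/
theorem exists_oscLE_refine {f : ∀ y, E.fiber y} {K : Set Ω} (hK : IsCompact K) {x : Ω}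
    (hx : x ∈ K) {ε ε' : ℝ} (hε' : 0 < ε') (hf : ∀ y ∈ K, OscLE f y ε) :
    ∃ g : ∀ y, E.fiber y, (∀ y ∈ K, OscLE g y ε') ∧ (∀ y ∈ K, ‖g y - f y‖ ≤ ε + ε') ∧
      g x = f x := by
  have hloc : ∀ y, ∃ (V : Set Ω) (g : ∀ y, E.fiber y), y ∈ K → IsOpen V ∧ y ∈ V ∧ g y = f y ∧
      ∀ z ∈ V, OscLE g z ε' ∧ ‖g z - f z‖ < ε + ε' := fun y => by
    by_cases hy : y ∈ K
    · obtain ⟨V, g, h1, h2, h3, h4⟩ :=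
        exists_local_oscLE (f y) hε' (hf y hy (ε + ε') (by linarith))
      exact ⟨V, g, fun _ => ⟨h1, h2, h3, h4⟩⟩
    · exact ⟨∅, f, fun h => (hy h).elim⟩
  choose V g hVg using hloc
  -- The sets centred at y ≠ x omit x. At x only selections centred at x contribute, which keeps the
  -- value there unchanged.
  obtain ⟨n, y, χ, hy, hχV, hsum, hχ0, -⟩ := exists_finite_partition hK
    (fun y => V y ∩ {z | z = x → y = x}) fun y hy => by
      refine ⟨(hVg y hy).1.inter ?_, (hVg y hy).2.1, id⟩
      by_cases hyx : y = x
      · simp [hyx]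
      · simpa [hyx] using (isOpen_ne : IsOpen {z | z ≠ x})
  refine ⟨fun z => ∑ i, (χ i z : 𝕜) • g (y i) z, fun z hz => ?_, fun z hz => ?_, ?_⟩
  · have h1 : OscLE (fun z => ∑ i, (χ i z : 𝕜) • g (y i) z) z (∑ i, |χ i z| * ε') :=
      OscLE.sum _ fun i _ => OscLE.smul_tsupport fun hi => ((hVg _ (hy i)).2.2.2 z (hχV i hi).1).1
    refine h1.mono (le_of_eq ?_)
    rw [← Finset.sum_mul, Finset.sum_congr rfl fun i _ => abs_of_nonneg (hχ0 i z), hsum z hz,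
      one_mul]
  · exact norm_sum_smul_sub_le (fun i => hχ0 i z) (hsum z hz) fun i hi =>
      ((hVg _ (hy i)).2.2.2 z (hχV i (subset_tsupport _ hi)).1).2.le
  · refine sub_eq_zero.1 (norm_le_zero_iff.1
      (norm_sum_smul_sub_le (fun i => hχ0 i x) (hsum x hx) fun i hi => ?_))
    have h1 : y i = x := (hχV i (subset_tsupport _ hi)).2 rfl
    have h2 := (hVg _ (hy i)).2.2.1
    rw [h1] at h2 ⊢
    simp [h2]

/-- Every vector of a Banach bundle over a locally compact space is a value of a continuous
section vanishing at infinity (Douady and dal Soglio-Hérault). -/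
theorem Section0.exists_apply_eq (x : Ω) (v : E.fiber x) : ∃ s : E.Section0, s x = v := by
  obtain ⟨V, g, hV, hxV, hgx, hg⟩ := exists_local_oscLE v one_pos univ_mem
  obtain ⟨K, hK, hKV, hKc⟩ := local_compact_nhds (hV.mem_nhds hxV)
  have hxK : x ∈ K := mem_of_mem_nhds hK
  let P : ℕ → (∀ y, E.fiber y) → Prop := fun n f =>
    f x = v ∧ ∀ y ∈ K, OscLE f y ((1 / 2 : ℝ) ^ n)
  -- The refinement moves f by at most 2⁻ⁿ + 2⁻⁽ⁿ⁺¹⁾, which is below 2 · 2⁻ⁿ and summable.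
  have step : ∀ n (f : {f // P n f}), ∃ f' : {f // P (n + 1) f},
      ∀ y ∈ K, ‖f'.1 y - f.1 y‖ ≤ 2 * (1 / 2 : ℝ) ^ n := fun n ⟨f, hfx, hf⟩ => by
    obtain ⟨f', h1, h2, h3⟩ := exists_oscLE_refine (ε' := (1 / 2 : ℝ) ^ (n + 1)) hKc hxK
      (by positivity) hf
    refine ⟨⟨f', h3.trans hfx, h1⟩, fun y hy => (h2 y hy).trans ?_⟩
    have : (0 : ℝ) < (1 / 2) ^ n := by positivity
    rw [pow_succ]
    linarith
  choose F hF using step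
  let f : ∀ n, {f // P n f} := fun n =>
    Nat.rec ⟨g, hgx, fun y hy => by simpa using (hg y (hKV hy)).1⟩ F n
  have hf : ∀ y ∈ K, ∀ n, dist ((f n).1 y) ((f (n + 1)).1 y) ≤ 2 * (1 / 2 : ℝ) ^ n :=
    fun y hy n => by
      rw [dist_comm, dist_eq_norm]
      exact hF n (f n) y hy
  have hlim : ∀ y, ∃ w, y ∈ K → Tendsto (fun n => (f n).1 y) atTop (𝓝 w) := fun y => by
    by_cases hy : y ∈ K
    · obtain ⟨w, hw⟩ := cauchySeq_tendsto_of_complete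
        (cauchySeq_of_le_geometric _ _ one_half_lt_one (hf y hy))
      exact ⟨w, fun _ => hw⟩
    · exact ⟨0, fun h => (hy h).elim⟩
  choose t ht using hlim
  have htx : t x = v := tendsto_nhds_unique (ht x hxK)
    (tendsto_const_nhds.congr fun n => (f n).2.1.symm)
  have htK : ∀ z ∈ interior K, OscLE t z 0 := fun z hz => OscLE.of_approx fun η hη => by
    -- The tail of the geometric series bounds the distance to the limit by 4 · 2⁻ⁿ.
    obtain ⟨n, hn⟩ := exists_pow_lt_of_lt_one (show 0 < η / 4 by linarith) one_half_lt_one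
    refine ⟨(f n).1, ((f n).2.2 z (interior_subset hz)).mono (by linarith), ?_⟩
    filter_upwards [isOpen_interior.mem_nhds hz] with y hy
    have h1 := dist_le_of_le_geometric_of_tendsto _ _ one_half_lt_one
      (hf y (interior_subset hy)) (ht y (interior_subset hy)) n
    have h2 : 2 * (1 / 2 : ℝ) ^ n / (1 - 1 / 2) = 4 * (1 / 2) ^ n := by ring
    rw [dist_eq_norm, h2] at h1
    exact h1.trans (by linarith)
  -- The limit is continuous only on the interior of K; the cutoff extends it by zero and keeps its
  -- value at x.
  obtain ⟨χ, hχ1, hχK, -, hχc⟩ := exists_cutoff isCompact_singleton isOpen_interior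
    (singleton_subset_iff.2 (mem_interior_iff_mem_nhds.2 hK))
  refine ⟨⟨fun y => (χ y : 𝕜) • t y, ?_, ?_⟩, ?_⟩
  · refine isContSection_iff.2 fun z => ?_
    simpa using OscLE.smul_tsupport (χ := χ) fun hz => htK z (hχK hz)
  · refine fun ε hε => ⟨tsupport χ, hχc, fun z hz => ?_⟩
    simpa [image_eq_zero_of_notMem_tsupport hz] using hε.le
  · simp [hχ1 x rfl, htx]

end BanachBundle

end Selection

/-! ### Positivity, maxima and absolute values in C₀(Ω) -/

namespace ZeroAtInftyContinuousMap

open Filter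

variable {𝕜 : Type k} [RCLike 𝕜] {Ω : Type u} [TopologicalSpace Ω]

theorem norm_apply_le_norm (f : C₀(Ω, 𝕜)) (x : Ω) : ‖f x‖ ≤ ‖f‖ := by
  rw [← norm_toBCF_eq_norm]
  exact f.toBCF.norm_coe_le_norm x

theorem norm_le_of_forall {f : C₀(Ω, 𝕜)} {C : ℝ} (hC : 0 ≤ C) (h : ∀ x, ‖f x‖ ≤ C) : ‖f‖ ≤ C := by
  rw [← norm_toBCF_eq_norm]
  exact (BoundedContinuousFunction.norm_le hC).2 h

theorem tendsto_zero_cocompact (f : C₀(Ω, 𝕜)) : Tendsto f (cocompact Ω) (𝓝 0) := f.zero_at_infty'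

/-- A compactly supported real function as an element of `C₀(Ω, 𝕜)`. -/
def ofCompactSupport (𝕜 : Type k) [RCLike 𝕜] (χ : C(Ω, ℝ)) (hχ : HasCompactSupport χ) :
    C₀(Ω, 𝕜) where
  toFun x := (χ x : 𝕜)
  continuous_toFun := by fun_prop
  zero_at_infty' := by
    simpa [Function.comp_def] using (RCLike.continuous_ofReal (K := 𝕜)).continuousAt.tendsto.comp
      hχ.is_zero_at_infty

@[simp] theorem ofCompactSupport_apply (χ : C(Ω, ℝ)) (hχ : HasCompactSupport χ) (x : Ω) :
    ofCompactSupport 𝕜 χ hχ x = (χ x : 𝕜) := rfl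

/-- A function is real and nonnegative. -/
def IsPos (f : C₀(Ω, 𝕜)) : Prop := ∀ x, 0 ≤ RCLike.re (f x) ∧ RCLike.im (f x) = 0

/-- The pointwise maximum of the real parts. -/
def reMax (f g : C₀(Ω, 𝕜)) : C₀(Ω, 𝕜) where
  toFun x := ((max (RCLike.re (f x)) (RCLike.re (g x)) : ℝ) : 𝕜)
  continuous_toFun := by fun_prop
  zero_at_infty' := by
    have h : ∀ f : C₀(Ω, 𝕜), Tendsto (fun x => RCLike.re (f x)) (cocompact Ω) (𝓝 0) := fun f => by
      simpa [Function.comp_def] using (RCLike.continuous_re (K := 𝕜)).continuousAt.tendsto.comp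
        f.tendsto_zero_cocompact
    have h2 : Tendsto (fun x => max (RCLike.re (f x)) (RCLike.re (g x))) (cocompact Ω) (𝓝 0) := by
      simpa using (h f).max (h g)
    simpa [Function.comp_def] using
      (RCLike.continuous_ofReal (K := 𝕜)).continuousAt.tendsto.comp h2

/-- The pointwise absolute value. -/
def absVal (f : C₀(Ω, 𝕜)) : C₀(Ω, 𝕜) where
  toFun x := ((‖f x‖ : ℝ) : 𝕜)
  continuous_toFun := by fun_prop
  zero_at_infty' := by
    simpa [Function.comp_def] using (RCLike.continuous_ofReal (K := 𝕜)).continuousAt.tendsto.comp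
      f.tendsto_zero_cocompact.norm

@[simp] theorem reMax_apply (f g : C₀(Ω, 𝕜)) (x : Ω) :
    reMax f g x = ((max (RCLike.re (f x)) (RCLike.re (g x)) : ℝ) : 𝕜) := rfl

@[simp] theorem absVal_apply (f : C₀(Ω, 𝕜)) (x : Ω) : absVal f x = ((‖f x‖ : ℝ) : 𝕜) := rfl

namespace IsPos

variable {f g h l : C₀(Ω, 𝕜)}

theorem ofReal_re (hf : IsPos f) (x : Ω) : ((RCLike.re (f x) : ℝ) : 𝕜) = f x :=
  RCLike.ext (by simp) (by simp [(hf x).2])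

theorem add (hf : IsPos f) (hg : IsPos g) : IsPos (f + g) := fun x => by
  simpa [(hf x).2, (hg x).2] using add_nonneg (hf x).1 (hg x).1

theorem reMax (hf : IsPos f) : IsPos (reMax f g) := fun x => by
  simp [(hf x).1]

theorem reMax_self (hf : IsPos f) : f.reMax f = f := by
  ext x
  simp [hf.ofReal_re]

theorem norm_apply (hf : IsPos f) (x : Ω) : ‖f x‖ = RCLike.re (f x) := by
  rw [← hf.ofReal_re x, RCLike.norm_ofReal, RCLike.ofReal_re, abs_of_nonneg (hf x).1]

theorem reMax_sub_reMax (hh : IsPos h) (hl : IsPos l) :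
    IsPos ((h + f).reMax (l + g) - f.reMax g) := fun x => by
  refine ⟨?_, by simp⟩
  have h1 := (hh x).1
  have h2 := (hl x).1
  simp only [ZeroAtInftyContinuousMap.sub_apply, reMax_apply,
    ZeroAtInftyContinuousMap.add_apply, map_add, map_sub, RCLike.ofReal_re, sub_nonneg]
  exact max_le_max (by linarith) (by linarith)

theorem reMax_sub_left (hf : IsPos f) : IsPos (f.reMax g - f) := fun x => by
  simp [(hf x).2]

theorem reMax_sub_right (hg : IsPos g) : IsPos (f.reMax g - g) := fun x => by
  simp [(hg x).2]

end IsPos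

end ZeroAtInftyContinuousMap

/-! ### Banach modules and the AM condition -/

section Modules

open Filter ZeroAtInftyContinuousMap

variable {𝕜 : Type k} [RCLike 𝕜] {Ω : Type u} [TopologicalSpace Ω]
  {G : Type w} [Group G] {S : Submonoid G}

namespace PreDynModule.IsBanachModule

variable {M : PreDynModule.{u, v} 𝕜 Ω S}

theorem norm_act_sub_act_le (hM : M.IsBanachModule) (f g : C₀(Ω, 𝕜)) (s : M.carrier) :
    ‖M.act f s - M.act g s‖ ≤ ‖f - g‖ * ‖s‖ := by
  rw [← LinearMap.sub_apply, ← map_sub]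
  exact hM.norm_act_le _ s

/-- If |f| ≤ |g|, then f is nearly qg with ‖q‖ ≤ 1, and q acts as a contraction. This holds in every
Banach module and makes the norm of Γ_s a lattice norm. -/
theorem norm_act_le_norm_act (hM : M.IsBanachModule) {f g : C₀(Ω, 𝕜)}
    (h : ∀ x, ‖f x‖ ≤ ‖g x‖) (s : M.carrier) :
    ‖M.act f s‖ ≤ ‖M.act g s‖ := by
  have key : ∀ η : ℝ, 0 < η → ‖M.act f s‖ ≤ ‖M.act g s‖ + η * ‖s‖ := fun η hη => by
    have hpos : ∀ x, 0 < ‖g x‖ ^ 2 + η ^ 2 := fun x => by positivity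
    -- A regularization of f/g. The error is f − qg = fη²/(|g|² + η²), of modulus at most η because
    -- |f| ≤ |g|.
    let q : C₀(Ω, 𝕜) :=
      { toFun := fun x => f x * (starRingEnd 𝕜) (g x) / ((‖g x‖ ^ 2 + η ^ 2 : ℝ) : 𝕜)
        continuous_toFun := by
          refine Continuous.div ((map_continuous f).mul
            (RCLike.continuous_conj.comp (map_continuous g))) (by fun_prop) fun x => ?_
          exact RCLike.ofReal_ne_zero.2 (hpos x).ne'
        zero_at_infty' := by
          have h1 := f.tendsto_zero_cocompact.mul
            ((RCLike.continuous_conj (K := 𝕜)).continuousAt.tendsto.comp g.tendsto_zero_cocompact)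
          have h2 : Tendsto (fun x => ((‖g x‖ ^ 2 + η ^ 2 : ℝ) : 𝕜)) (cocompact Ω)
              (𝓝 ((‖(0 : 𝕜)‖ ^ 2 + η ^ 2 : ℝ) : 𝕜)) :=
            (RCLike.continuous_ofReal (K := 𝕜)).continuousAt.tendsto.comp
              ((g.tendsto_zero_cocompact.norm.pow 2).add_const _)
          have h3 := h1.div h2 (RCLike.ofReal_ne_zero.2 (by positivity))
          simpa [Pi.div_def] using h3 }
    have hq : ‖q‖ ≤ 1 := norm_le_of_forall zero_le_one fun x => by
      change ‖f x * (starRingEnd 𝕜) (g x) / ((‖g x‖ ^ 2 + η ^ 2 : ℝ) : 𝕜)‖ ≤ 1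
      rw [norm_div, norm_mul, RCLike.norm_conj, RCLike.norm_ofReal, abs_of_pos (hpos x),
        div_le_one (hpos x)]
      nlinarith [h x, norm_nonneg (g x), sq_nonneg η]
    have hd : ‖f - q * g‖ ≤ η := norm_le_of_forall hη.le fun x => by
      have h0 : ((‖g x‖ ^ 2 + η ^ 2 : ℝ) : 𝕜) ≠ 0 := RCLike.ofReal_ne_zero.2 (hpos x).ne'
      have h1 : (f - q * g) x = f x * ((η ^ 2 : ℝ) : 𝕜) / ((‖g x‖ ^ 2 + η ^ 2 : ℝ) : 𝕜) := by
        change f x - f x * (starRingEnd 𝕜) (g x) / ((‖g x‖ ^ 2 + η ^ 2 : ℝ) : 𝕜) * g x = _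
        rw [eq_div_iff h0, sub_mul, div_mul_eq_mul_div, div_mul_cancel₀ _ h0, mul_assoc (f x),
          RCLike.conj_mul, ← mul_sub]
        congr 1
        push_cast
        ring
      rw [h1, norm_div, norm_mul, RCLike.norm_ofReal, RCLike.norm_ofReal, abs_of_pos (hpos x),
        abs_of_nonneg (sq_nonneg η), div_le_iff₀ (hpos x)]
      have h2 : ‖f x‖ * η ^ 2 ≤ ‖g x‖ * η ^ 2 := mul_le_mul_of_nonneg_right (h x) (sq_nonneg η)
      nlinarith [sq_nonneg (‖g x‖ - η), norm_nonneg (g x), mul_nonneg (norm_nonneg (g x)) hη.le,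
        mul_nonneg hη.le (sq_nonneg (‖g x‖ - η)), mul_nonneg (norm_nonneg (g x)) (sq_nonneg η)]
    have h1 : M.act f s = M.act (f - q * g) s + M.act q (M.act g s) := by
      rw [← hM.mul_act, ← LinearMap.add_apply, ← map_add, sub_add_cancel]
    rw [h1, add_comm]
    refine (norm_add_le _ _).trans (add_le_add ?_ ?_)
    · exact (hM.norm_act_le _ _).trans (mul_le_of_le_one_left (norm_nonneg _) hq)
    · exact (hM.norm_act_le _ _).trans (mul_le_mul_of_nonneg_right hd (norm_nonneg _))
  have h1 : Tendsto (fun η : ℝ => ‖M.act g s‖ + η * ‖s‖) (𝓝[>] 0)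
      (𝓝 (‖M.act g s‖ + 0 * ‖s‖)) :=
    ((continuous_const.add (continuous_id.mul continuous_const)).tendsto 0).mono_left
      nhdsWithin_le_nhds
  rw [zero_mul, add_zero] at h1
  exact ge_of_tendsto h1 (eventually_nhdsWithin_of_forall key)

/-- Pointwise, the difference of two maxima is at most |f − f'| + |g − g'|, so monotonicity of the
norm applies. Thus maxima pass to limits in Γ_s, although f is not determined by fs. -/
theorem norm_act_reMax_sub_le (hM : M.IsBanachModule) (f g f' g' : C₀(Ω, 𝕜)) (s : M.carrier) :
    ‖M.act (f.reMax g) s - M.act (f'.reMax g') s‖ ≤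
      ‖M.act f s - M.act f' s‖ + ‖M.act g s - M.act g' s‖ := by
  have habs : ∀ h : C₀(Ω, 𝕜), ‖M.act h.absVal s‖ ≤ ‖M.act h s‖ := fun h =>
    hM.norm_act_le_norm_act (fun x => by simp) s
  simp only [← LinearMap.sub_apply, ← map_sub]
  have h1 : ‖M.act (f.reMax g - f'.reMax g') s‖ ≤
      ‖M.act ((f - f').absVal + (g - g').absVal) s‖ := by
    refine hM.norm_act_le_norm_act (fun x => ?_) s
    simp only [ZeroAtInftyContinuousMap.sub_apply, ZeroAtInftyContinuousMap.add_apply, reMax_apply,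
      absVal_apply]
    rw [← RCLike.ofReal_sub, ← RCLike.ofReal_add, RCLike.norm_ofReal, RCLike.norm_ofReal,
      abs_of_nonneg (add_nonneg (norm_nonneg (f x - f' x)) (norm_nonneg (g x - g' x)))]
    refine (abs_max_sub_max_le_max _ _ _ _).trans (max_le ?_ ?_)
    · rw [← map_sub]
      exact (RCLike.abs_re_le_norm _).trans (le_add_of_nonneg_right (norm_nonneg _))
    · rw [← map_sub]
      exact (RCLike.abs_re_le_norm _).trans (le_add_of_nonneg_left (norm_nonneg _))
  refine h1.trans ?_
  rw [map_add, LinearMap.add_apply]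
  exact (norm_add_le _ _).trans (add_le_add (habs _) (habs _))

theorem act_mem_cyclicCone {f : C₀(Ω, 𝕜)} (hf : f.IsPos) (s : M.carrier) :
    M.act f s ∈ M.cyclicCone s := subset_closure ⟨f, hf, rfl⟩

theorem exists_seq_of_mem_cyclicCone {s t : M.carrier} (ht : t ∈ M.cyclicCone s) :
    ∃ f : ℕ → C₀(Ω, 𝕜), (∀ n, (f n).IsPos) ∧ Tendsto (fun n => M.act (f n) s) atTop (𝓝 t) := by
  obtain ⟨r, hr, hrt⟩ := mem_closure_iff_seq_limit.1 ht
  choose f hf hfr using hr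
  exact ⟨f, hf, hrt.congr hfr⟩

theorem tendsto_act_reMax (hM : M.IsBanachModule) {s z : M.carrier} {f g : ℕ → C₀(Ω, 𝕜)}
    (hf0 : ∀ n, (f n).IsPos)
    (hf : Tendsto (fun n => M.act (f n) s) atTop (𝓝 z))
    (hg : Tendsto (fun n => M.act (g n) s) atTop (𝓝 z)) :
    Tendsto (fun n => M.act ((f n).reMax (g n)) s) atTop (𝓝 z) := by
  have h1 : Tendsto (fun n => M.act ((f n).reMax (g n)) s - M.act (f n) s) atTop (𝓝 0) := by
    have h2 : Tendsto (fun n => ‖M.act (g n) s - M.act (f n) s‖) atTop (𝓝 0) := by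
      simpa using (hg.sub hf).norm
    refine squeeze_zero_norm (fun n => ?_) h2
    have h3 := hM.norm_act_reMax_sub_le (f n) (g n) (f n) (f n) s
    rwa [(hf0 n).reMax_self, sub_self, norm_zero, zero_add] at h3
  simpa using h1.add hf

/-- The cyclic submodule `Γ_s` is an AM-space if and only if its norm is compatible with the
maximum of nonnegative functions. -/
theorem isCyclicAMSpace_iff (hM : M.IsBanachModule) (s : M.carrier) :
    M.IsCyclicAMSpace s ↔ ∀ f g : C₀(Ω, 𝕜), f.IsPos → g.IsPos →
      ‖M.act (f.reMax g) s‖ ≤ max ‖M.act f s‖ ‖M.act g s‖ := by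
  constructor
  · intro h f g hf hg
    obtain ⟨w, ⟨h1, h2, -⟩, hw⟩ :=
      h _ (act_mem_cyclicCone hf s) _ (act_mem_cyclicCone hg s)
    obtain ⟨a, ha, haw⟩ := exists_seq_of_mem_cyclicCone h1
    obtain ⟨b, hb, hbw⟩ := exists_seq_of_mem_cyclicCone h2
    have ha' : Tendsto (fun n => M.act (a n + f) s) atTop (𝓝 w) := by
      simpa using haw.add_const (M.act f s)
    have hb' : Tendsto (fun n => M.act (b n + g) s) atTop (𝓝 w) := by
      simpa using hbw.add_const (M.act g s)
    rw [← hw]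
    -- Both (aₙ + f)s and (bₙ + g)s tend to w, hence so does max(aₙ + f, bₙ + g)s; these functions
    -- dominate max(f, g).
    refine ge_of_tendsto (hM.tendsto_act_reMax (fun n => (ha n).add hf) ha' hb').norm
      (.of_forall fun n => hM.norm_act_le_norm_act (fun x => ?_) s)
    rw [hf.reMax.norm_apply, ((ha n).add hf).reMax.norm_apply]
    simpa using (((ha n).reMax_sub_reMax (hb n)) x).1
  · intro h t ht u hu
    have := hM.complete
    obtain ⟨f, hf, hft⟩ := exists_seq_of_mem_cyclicCone ht
    obtain ⟨g, hg, hgu⟩ := exists_seq_of_mem_cyclicCone hu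
    -- The limit of max(fₙ, gₙ)s will be the supremum of t and u.
    have hcau : CauchySeq fun n => M.act ((f n).reMax (g n)) s := by
      refine Metric.cauchySeq_iff'.2 fun ε hε => ?_
      obtain ⟨N, hN⟩ := Metric.cauchySeq_iff.1 hft.cauchySeq (ε / 2) (half_pos hε)
      obtain ⟨N', hN'⟩ := Metric.cauchySeq_iff.1 hgu.cauchySeq (ε / 2) (half_pos hε)
      refine ⟨max N N', fun n hn => ?_⟩
      have h1 := hN n (le_of_max_le_left hn) (max N N') (le_max_left _ _)
      have h2 := hN' n (le_of_max_le_right hn) (max N N') (le_max_right _ _)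
      rw [dist_eq_norm] at h1 h2 ⊢
      exact (hM.norm_act_reMax_sub_le _ _ _ _ s).trans_lt (by linarith)
    obtain ⟨w, hw⟩ := cauchySeq_tendsto_of_complete hcau
    refine ⟨w, ⟨?_, ?_, fun z hz hz' => ?_⟩, ?_⟩
    · refine isClosed_closure.mem_of_tendsto (hw.sub hft) (.of_forall fun n => ?_)
      rw [← LinearMap.sub_apply, ← map_sub]
      exact act_mem_cyclicCone (hf n).reMax_sub_left s
    · refine isClosed_closure.mem_of_tendsto (hw.sub hgu) (.of_forall fun n => ?_)
      rw [← LinearMap.sub_apply, ← map_sub]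
      exact act_mem_cyclicCone (hg n).reMax_sub_right s
    · obtain ⟨a, ha, haz⟩ := exists_seq_of_mem_cyclicCone hz
      obtain ⟨b, hb, hbz⟩ := exists_seq_of_mem_cyclicCone hz'
      have ha' : Tendsto (fun n => M.act (a n + f n) s) atTop (𝓝 z) := by
        simpa using haz.add hft
      have hb' : Tendsto (fun n => M.act (b n + g n) s) atTop (𝓝 z) := by
        simpa using hbz.add hgu
      refine isClosed_closure.mem_of_tendsto
        ((hM.tendsto_act_reMax (fun n => (ha n).add (hf n)) ha' hb').sub hw)
        (.of_forall fun n => ?_)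
      rw [← LinearMap.sub_apply, ← map_sub]
      exact act_mem_cyclicCone ((ha n).reMax_sub_reMax (hb n)) s
    · refine tendsto_nhds_unique hw.norm ((hft.norm.max hgu.norm).congr fun n => ?_)
      refine le_antisymm (max_le ?_ ?_) (h _ _ (hf n) (hg n))
      · refine hM.norm_act_le_norm_act (fun x => ?_) s
        rw [(hf n).norm_apply, (hf n).reMax.norm_apply]
        simp
      · refine hM.norm_act_le_norm_act (fun x => ?_) s
        rw [(hg n).norm_apply, (hf n).reMax.norm_apply]
        simp

/-- Functions which are `1` on a large compact set act on `s` nearly as the identity. -/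
theorem exists_compact_approx_unit (hM : M.IsBanachModule) (s : M.carrier) {ε : ℝ} (hε : 0 < ε) :
    ∃ K : Set Ω, IsCompact K ∧ ∀ e : C₀(Ω, 𝕜), (∀ x, ‖e x‖ ≤ 1) → (∀ x ∈ K, e x = 1) →
      ‖M.act e s - s‖ ≤ ε := by
  have hmem : s ∈ closure (Submodule.span 𝕜
      {t | ∃ (f : C₀(Ω, 𝕜)) (s : M.carrier), t = M.act f s} : Set M.carrier) := by
    rw [hM.nondegenerate]
    trivial
  have key : ∀ t ∈ Submodule.span 𝕜 {t | ∃ (f : C₀(Ω, 𝕜)) (s : M.carrier), t = M.act f s},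
      ∀ ε > 0, ∃ K : Set Ω, IsCompact K ∧ ∀ e : C₀(Ω, 𝕜), (∀ x, ‖e x‖ ≤ 1) →
      (∀ x ∈ K, e x = 1) → ‖M.act e t - t‖ ≤ ε := by
    intro t ht
    induction ht using Submodule.span_induction with
    | mem t ht =>
      obtain ⟨f, s, rfl⟩ := ht
      intro ε hε
      -- Off K only |ef − f| ≤ 2|f| is available, hence the factor 2; the summand 1 allows s = 0.
      have hδ : 0 < ε / (‖s‖ + 1) / 2 := by positivity
      obtain ⟨K, hK, hKf⟩ := mem_cocompact.1
        (f.tendsto_zero_cocompact.norm.eventually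
          (ge_mem_nhds (by rwa [norm_zero] : ‖(0 : 𝕜)‖ < ε / (‖s‖ + 1) / 2)))
      refine ⟨K, hK, fun e he heK => ?_⟩
      have h1 : ‖e * f - f‖ ≤ ε / (‖s‖ + 1) := norm_le_of_forall (by positivity) fun x => by
        by_cases hx : x ∈ K
        · simp only [ZeroAtInftyContinuousMap.sub_apply, ZeroAtInftyContinuousMap.mul_apply, heK x hx,
            one_mul, sub_self, norm_zero]
          positivity
        · have h2 : ‖f x‖ ≤ ε / (‖s‖ + 1) / 2 := hKf hx
          have h3 : ‖(e * f - f) x‖ ≤ ‖e x * f x‖ + ‖f x‖ := norm_sub_le (e x * f x) (f x)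
          rw [norm_mul] at h3
          nlinarith [he x, norm_nonneg (f x), norm_nonneg (e x)]
      rw [← hM.mul_act]
      refine (hM.norm_act_sub_act_le _ _ s).trans ((mul_le_mul_of_nonneg_right h1
        (norm_nonneg s)).trans ?_)
      rw [div_mul_eq_mul_div, div_le_iff₀ (by positivity)]
      nlinarith [norm_nonneg s]
    | zero => exact fun ε hε => ⟨∅, isCompact_empty, fun e _ _ => by simpa using hε.le⟩
    | add t u _ _ iht ihu =>
      intro ε hε
      obtain ⟨K, hK, h⟩ := iht (ε / 2) (half_pos hε)
      obtain ⟨L, hL, h'⟩ := ihu (ε / 2) (half_pos hε)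
      refine ⟨K ∪ L, hK.union hL, fun e he heK => ?_⟩
      rw [map_add, add_sub_add_comm]
      refine (norm_add_le _ _).trans ?_
      linarith [h e he fun x hx => heK x (Or.inl hx), h' e he fun x hx => heK x (Or.inr hx)]
    | smul c t _ iht =>
      intro ε hε
      obtain ⟨K, hK, h⟩ := iht (ε / (‖c‖ + 1)) (by positivity)
      refine ⟨K, hK, fun e he heK => ?_⟩
      rw [map_smul, ← smul_sub, norm_smul]
      have h1 := h e he heK
      rw [le_div_iff₀ (by positivity)] at h1
      nlinarith [norm_nonneg (M.act e t - t)]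
  -- One third each for e(s − t), et − t and s − t.
  obtain ⟨t, ht, hst⟩ := Metric.mem_closure_iff.1 hmem (ε / 3) (by linarith)
  obtain ⟨K, hK, h⟩ := key t ht (ε / 3) (by linarith)
  refine ⟨K, hK, fun e he heK => ?_⟩
  rw [dist_eq_norm] at hst
  have h1 : M.act e s - s = M.act e (s - t) + (M.act e t - t) - (s - t) := by
    rw [map_sub]
    abel
  have h2 : ‖M.act e (s - t)‖ ≤ ‖s - t‖ := (hM.norm_act_le _ _).trans
    (mul_le_of_le_one_left (norm_nonneg _) (norm_le_of_forall zero_le_one he))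
  rw [h1]
  refine (norm_sub_le _ _).trans ((add_le_add_left (norm_add_le _ _) _).trans ?_)
  linarith [h e he heK]

end PreDynModule.IsBanachModule
end Modules

/-! ### Section spaces are dynamical AM-modules -/

section SectionModule

open Filter ZeroAtInftyContinuousMap

namespace BanachBundle

variable {𝕜 : Type k} [RCLike 𝕜] {Ω : Type u} [TopologicalSpace Ω] {E F : BanachBundle.{u, v} 𝕜 Ω}

namespace Section0

theorem ext_mk {s t : E.Section0} (h : ∀ x, (⟨x, s x⟩ : E.Total) = ⟨x, t x⟩) : s = t :=
  ext fun x => by simpa using h x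

theorem mk_congr (s : E.Section0) {x y : Ω} (h : x = y) : (⟨x, s x⟩ : E.Total) = ⟨y, s y⟩ := by
  subst h
  rfl

theorem act_mul_apply (f g : C₀(Ω, 𝕜)) (s : E.Section0) :
    act E (f * g) s = act E f (act E g s) :=
  ext fun x => mul_smul (f x) (g x) (s x)

theorem norm_act_le (f : C₀(Ω, 𝕜)) (s : E.Section0) : ‖act E f s‖ ≤ ‖f‖ * ‖s‖ := by
  refine norm_le_of (by positivity) fun x => ?_
  rw [act_apply, norm_smul]
  exact mul_le_mul (norm_apply_le_norm f x) (s.norm_apply_le x) (norm_nonneg _) (norm_nonneg _)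

/-- At each point the maximum is one of the two functions, and the norm is a supremum over points.
-/
theorem norm_act_reMax_le {f g : C₀(Ω, 𝕜)} (hf : f.IsPos) (hg : g.IsPos) (s : E.Section0) :
    ‖act E (f.reMax g) s‖ ≤ max ‖act E f s‖ ‖act E g s‖ := by
  refine norm_le_of (le_max_of_le_left (norm_nonneg _)) fun x => ?_
  rw [act_apply, norm_smul, hf.reMax.norm_apply, reMax_apply, RCLike.ofReal_re]
  rcases le_total (RCLike.re (f x)) (RCLike.re (g x)) with h | h
  · rw [max_eq_right h, ← hg.norm_apply, ← norm_smul]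
    exact le_max_of_le_right ((act E g s).norm_apply_le x)
  · rw [max_eq_left h, ← hf.norm_apply, ← norm_smul]
    exact le_max_of_le_left ((act E f s).norm_apply_le x)

theorem exists_norm_act_cutoff_sub_le [T2Space Ω] [LocallyCompactSpace Ω] (s : E.Section0) {ε : ℝ}
    (hε : 0 < ε) :
    ∃ (χ : C(Ω, ℝ)) (hχ : HasCompactSupport χ), (∀ x, 0 ≤ χ x ∧ χ x ≤ 1) ∧
      ‖act E (ofCompactSupport 𝕜 χ hχ) s - s‖ ≤ ε := by
  obtain ⟨K, hK, h⟩ := s.vanishes ε hε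
  obtain ⟨χ, h1, -, h2, hχ⟩ := exists_cutoff hK isOpen_univ (Set.subset_univ K)
  refine ⟨χ, hχ, h2, norm_le_of hε.le fun x => ?_⟩
  rw [sub_apply, act_apply, ofCompactSupport_apply]
  by_cases hx : x ∈ K
  · simpa [h1 x hx] using hε.le
  · have h3 : (χ x : 𝕜) • s x - s x = ((χ x - 1 : ℝ) : 𝕜) • s x := by
      rw [RCLike.ofReal_sub, sub_smul, RCLike.ofReal_one, one_smul]
    rw [h3, norm_smul, RCLike.norm_ofReal]
    refine (mul_le_of_le_one_left (norm_nonneg _) (abs_le.2 ?_)).trans (h x hx)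
    exact ⟨by linarith [h2 x], by linarith [h2 x]⟩

end Section0

theorem Morphism.norm_weightedKoopman_apply_le (φ : Ω ≃ₜ Ω) (Φ : Morphism φ E F) {C : ℝ}
    (hC : ∀ x, ‖Φ.app x‖ ≤ C) (s : E.Section0) (x : Ω) :
    ‖Φ.weightedKoopman φ s x‖ ≤ C * ‖s (φ.symm x)‖ :=
  (LinearIsometryEquiv.norm_map (F.fiberCast (φ.apply_symm_apply x)) _).le.trans
    ((Φ.app _).le_of_opNorm_le (hC _) _)

theorem Morphism.weightedKoopman_act (φ : Ω ≃ₜ Ω) (Φ : Morphism φ E F) {f f' : C₀(Ω, 𝕜)}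
    (hf : ∀ x, f' x = f (φ.symm x)) (s : E.Section0) :
    Φ.weightedKoopman φ (Section0.act E f s) = Section0.act F f' (Φ.weightedKoopman φ s) := by
  refine Section0.ext fun x => ?_
  rw [Section0.act_apply, hf]
  change F.fiberCast _ (Φ.app _ (f (φ.symm x) • s (φ.symm x))) =
    f (φ.symm x) • F.fiberCast _ (Φ.app _ (s (φ.symm x)))
  rw [map_smul, map_smul]

end BanachBundle

namespace DynBundle

open BanachBundle

variable {𝕜 : Type k} [RCLike 𝕜] {Ω : Type u} [TopologicalSpace Ω]
  {G : Type w} [Group G] [TopologicalSpace G] [MulAction G Ω]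

section

variable [ContinuousConstSMul G Ω] {S : Submonoid G} (E : DynBundle.{u, v} 𝕜 Ω S)

/-- The weighted Koopman operators of a dynamical Banach bundle. -/
noncomputable def koop (g : S) : E.bundle.Section0 →L[𝕜] E.bundle.Section0 :=
  (E.dyn g).weightedKoopman (Homeomorph.smul (g : G))

theorem mk_koop (g : S) (s : E.bundle.Section0) (x : Ω) :
    (⟨x, E.koop g s x⟩ : E.bundle.Total) =
      (E.dyn g).onTotal ⟨(g : G)⁻¹ • x, s ((g : G)⁻¹ • x)⟩ :=
  Morphism.mk_weightedKoopman_apply _ _ s x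

theorem mk_koop_smul (g : S) (s : E.bundle.Section0) (x : Ω) :
    (⟨(g : G) • x, E.koop g s ((g : G) • x)⟩ : E.bundle.Total) = (E.dyn g).onTotal ⟨x, s x⟩ := by
  rw [mk_koop, s.mk_congr (inv_smul_smul (g : G) x)]

theorem koop_one : E.koop 1 = ContinuousLinearMap.id 𝕜 _ := by
  refine ContinuousLinearMap.ext fun s => Section0.ext_mk fun x => ?_
  rw [mk_koop, E.dyn_one]
  exact s.mk_congr (by simp)

theorem koop_mul (g h : S) : E.koop (g * h) = (E.koop g).comp (E.koop h) := by
  refine ContinuousLinearMap.ext fun s => Section0.ext_mk fun x => ?_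
  rw [mk_koop, E.dyn_mul, ContinuousLinearMap.comp_apply, mk_koop, mk_koop, Function.comp_apply,
    s.mk_congr (y := (h : G)⁻¹ • (g : G)⁻¹ • x) (by simp [mul_smul])]

theorem koop_act (g : S) (f : C₀(Ω, 𝕜)) (s : E.bundle.Section0) :
    E.koop g (Section0.act _ f s) = Section0.act _ (koopman 𝕜 Ω (g : G) f) (E.koop g s) :=
  Morphism.weightedKoopman_act _ _ (fun _ => rfl) s

end

variable [ContinuousSMul G Ω] {S : Submonoid G} (E : DynBundle.{u, v} 𝕜 Ω S)

/-- For g in a compact neighbourhood N of g₀, all transported sections are small outside the compact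
set NK, where s is small off K. On NK, joint continuity and upper semicontinuity of the norm give
pointwise estimates, which compactness makes uniform. -/
theorem continuous_koop [IsTopologicalGroup G] [LocallyCompactSpace S] (s : E.bundle.Section0) :
    Continuous (fun g : S => E.koop g s) := by
  refine continuous_iff_continuousAt.2 fun g₀ => Metric.tendsto_nhds.2 fun ε hε => ?_
  obtain ⟨N, hN, hgN⟩ := exists_compact_mem_nhds g₀
  obtain ⟨C₁, hC₁⟩ := E.locally_bounded N hN
  obtain ⟨C, hC0, hC⟩ : ∃ C ≥ 0, ∀ g ∈ N, ∀ x, ‖(E.dyn g).app x‖ ≤ C :=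
    ⟨max C₁ 0, le_max_right _ _, fun g hg x => (hC₁ g hg x).trans (le_max_left _ _)⟩
  obtain ⟨K, hK, hKs⟩ := s.vanishes (ε / 4 / (C + 1)) (by positivity)
  have hL : IsCompact ((fun q : S × Ω => (q.1 : G) • q.2) '' (N ×ˢ K)) :=
    (hN.prod hK).image (by fun_prop)
  have hout : ∀ g ∈ N, ∀ x, x ∉ (fun q : S × Ω => (q.1 : G) • q.2) '' (N ×ˢ K) →
      ‖E.koop g s x‖ ≤ ε / 4 := fun g hg x hx => by
    refine (Morphism.norm_weightedKoopman_apply_le _ _ (hC g hg) s x).trans ?_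
    have h1 := hKs ((g : G)⁻¹ • x) fun h => hx ⟨(g, (g : G)⁻¹ • x), ⟨hg, h⟩, smul_inv_smul _ _⟩
    rw [le_div_iff₀ (by positivity)] at h1
    change C * ‖s ((g : G)⁻¹ • x)‖ ≤ _
    nlinarith [norm_nonneg (s ((g : G)⁻¹ • x))]
  have hcont : Continuous fun q : S × Ω => (⟨q.2, E.koop q.1 s q.2⟩ : E.bundle.Total) := by
    simp only [mk_koop]
    have h1 : Continuous fun q : S × Ω => ((q.1 : S) : G)⁻¹ • q.2 := by fun_prop
    exact E.jointly_continuous.comp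
      (f := fun q : S × Ω => (q.1, (⟨((q.1 : S) : G)⁻¹ • q.2, s _⟩ : E.bundle.Total)))
      (continuous_fst.prodMk (s.continuous.comp h1))
  -- The tube lemma: the difference tends to a zero vector as (g, y) → (g₀, x), so its norm is
  -- eventually small.
  have hin := hL.eventually_forall_of_forall_eventually (x₀ := g₀)
    (P := fun g x => ‖E.koop g s x - E.koop g₀ s x‖ < ε / 2) fun x _ => by
      refine eventually_norm_lt (E := E.bundle) (x := x)
        (v := E.koop g₀ s x - E.koop g₀ s x) (tendsto_sub ?_ ?_) (by simpa using hε)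
      · exact hcont.tendsto (g₀, x)
      · exact ((E.koop g₀ s).tendsto x).comp (continuous_snd.tendsto (g₀, x))
  filter_upwards [hgN, hin] with g hg hgL
  rw [dist_eq_norm]
  refine (Section0.norm_le_of (half_pos hε).le fun x => ?_).trans_lt (half_lt_self hε)
  by_cases hx : x ∈ (fun q : S × Ω => (q.1 : G) • q.2) '' (N ×ˢ K)
  · exact (hgL x hx).le
  · refine (norm_sub_le _ _).trans ?_
    linarith [hout g hg x hx, hout g₀ (mem_of_mem_nhds hgN) x hx]

end DynBundle

open BanachBundle in
theorem isDynAMModule_sectionFunctor {𝕜 : Type k} [RCLike 𝕜] {Ω : Type u} [TopologicalSpace Ω]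
    [T2Space Ω] [LocallyCompactSpace Ω] {G : Type w} [Group G] [TopologicalSpace G]
    [IsTopologicalGroup G] [MulAction G Ω] [ContinuousSMul G Ω] {S : Submonoid G}
    [LocallyCompactSpace S] (E : DynBundle.{u, v} 𝕜 Ω S) :
    ((sectionFunctor 𝕜 Ω S).obj E).IsDynAMModule := by
  have hB : ((sectionFunctor 𝕜 Ω S).obj E).IsBanachModule :=
    { complete := inferInstanceAs (CompleteSpace E.bundle.Section0)
      mul_act := Section0.act_mul_apply
      norm_act_le := Section0.norm_act_le
      nondegenerate := by
        refine Set.eq_univ_iff_forall.2 fun (s : E.bundle.Section0) =>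
          Metric.mem_closure_iff.2 fun ε hε => ?_
        obtain ⟨χ, hχ, -, h⟩ := s.exists_norm_act_cutoff_sub_le (half_pos hε)
        refine ⟨Section0.act _ (ofCompactSupport 𝕜 χ hχ) s,
          Submodule.subset_span ⟨_, s, rfl⟩, ?_⟩
        exact (dist_comm (α := E.bundle.Section0) _ _).trans_lt
          ((dist_eq_norm (Section0.act _ (ofCompactSupport 𝕜 χ hχ) s) s).trans_lt
            (h.trans_lt (half_lt_self hε))) }
  exact
    { toIsBanachModule := hB
      op_one := E.koop_one
      op_mul := E.koop_mul
      op_act := E.koop_act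
      strongly_continuous := E.continuous_koop
      am := fun s => (hB.isCyclicAMSpace_iff s).2 fun f g hf hg =>
        Section0.norm_act_reMax_le hf hg s }

end SectionModule

/-! ### Operators between section spaces come from bundle morphisms -/

section FullyFaithful

open Filter ZeroAtInftyContinuousMap

namespace BanachBundle

variable {𝕜 : Type k} [RCLike 𝕜] {Ω : Type u} [TopologicalSpace Ω] [T2Space Ω]
  [LocallyCompactSpace Ω] {E F : BanachBundle.{u, v} 𝕜 Ω}

theorem Section0.exists_cutoff_norm_le (s : E.Section0) {x : Ω} {c : ℝ} (hc : ‖s x‖ < c) :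
    ∃ f : C₀(Ω, 𝕜), f x = 1 ∧ ‖act E f s‖ ≤ c := by
  have hU : {y | ‖s y‖ < c} ∈ 𝓝 x := eventually_norm_lt (s.tendsto x) hc
  obtain ⟨χ, h1, h2, h3, hχ⟩ := exists_cutoff isCompact_singleton isOpen_interior
    (Set.singleton_subset_iff.2 (mem_interior_iff_mem_nhds.2 hU))
  refine ⟨ofCompactSupport 𝕜 χ hχ, by simp [h1 x rfl],
    norm_le_of ((norm_nonneg _).trans hc.le) fun y => ?_⟩
  rw [act_apply, ofCompactSupport_apply, norm_smul, RCLike.norm_ofReal, abs_of_nonneg (h3 y).1]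
  by_cases hy : χ y = 0
  · rw [hy, zero_mul]
    exact (norm_nonneg _).trans hc.le
  · have h4 : y ∈ {y | ‖s y‖ < c} := interior_subset (h2 (subset_tsupport _ hy))
    exact (mul_le_of_le_one_left (norm_nonneg _) (h3 y).2).trans (le_of_lt h4)

/-- Multiplying s by f with f(x) = 1 does not change (Vs)(x), while ‖fs‖ can be brought arbitrarily
close to ‖s(x)‖. In particular (Vs)(x) depends only on s(x). -/
theorem norm_map_section_apply_le (V : E.Section0 →L[𝕜] F.Section0)
    (hV : ∀ f s, V (Section0.act E f s) = Section0.act F f (V s)) (s : E.Section0) (x : Ω) :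
    ‖V s x‖ ≤ ‖V‖ * ‖s x‖ := by
  have key : ∀ c > ‖s x‖, ‖V s x‖ ≤ ‖V‖ * c := fun c hc => by
    obtain ⟨f, hfx, hf⟩ := s.exists_cutoff_norm_le hc
    have h1 : V s x = V (Section0.act E f s) x := by
      rw [hV, Section0.act_apply, hfx, one_smul]
    rw [h1]
    exact ((V _).norm_apply_le x).trans ((V.le_opNorm _).trans
      (mul_le_mul_of_nonneg_left hf (norm_nonneg _)))
  have h1 : Tendsto (fun c : ℝ => ‖V‖ * c) (𝓝[>] ‖s x‖) (𝓝 (‖V‖ * ‖s x‖)) :=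
    ((continuous_const.mul continuous_id).tendsto _).mono_left nhdsWithin_le_nhds
  exact ge_of_tendsto h1 (eventually_nhdsWithin_of_forall key)

/-- A bounded `C₀(Ω)`-linear operator between section spaces comes from a bundle morphism. -/
theorem exists_morphism_apply_eq (V : E.Section0 →L[𝕜] F.Section0)
    (hV : ∀ f s, V (Section0.act E f s) = Section0.act F f (V s)) :
    ∃ Θ : Morphism id E F, ∀ (s : E.Section0) (x : Ω), Θ.app x (s x) = V s x := by
  choose σ hσ using fun x (v : E.fiber x) => Section0.exists_apply_eq x v
  have hloc : ∀ (s t : E.Section0) (x : Ω), s x = t x → V s x = V t x := fun s t x h => by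
    have h1 := norm_map_section_apply_le V hV (s - t) x
    rw [map_sub, Section0.sub_apply, Section0.sub_apply, h, sub_self, norm_zero, mul_zero] at h1
    exact sub_eq_zero.1 (norm_le_zero_iff.1 h1)
  let A : ∀ x, E.fiber x →L[𝕜] F.fiber x := fun x => LinearMap.mkContinuous
    { toFun := fun v => V (σ x v) x
      map_add' := fun v w => by
        rw [hloc (σ x (v + w)) (σ x v + σ x w) x (by simp [hσ]), map_add, Section0.add_apply]
      map_smul' := fun c v => by
        rw [hloc (σ x (c • v)) (c • σ x v) x (by simp [hσ]), map_smul, Section0.smul_apply,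
          RingHom.id_apply] } ‖V‖ fun v => by
        simpa [hσ] using norm_map_section_apply_le V hV (σ x v) x
  have hA : ∀ (s : E.Section0) (x : Ω), A x (s x) = V s x := fun s x => hloc _ _ x (hσ _ _)
  have hA' : ∀ x v, ‖A x v‖ ≤ ‖V‖ * ‖v‖ := fun x v =>
    (norm_map_section_apply_le V hV (σ x v) x).trans_eq (by rw [hσ])
  refine ⟨⟨A, continuous_iff_continuousAt.2 ?_, ‖V‖, fun x =>
    LinearMap.mkContinuous_norm_le _ (norm_nonneg _) _⟩, hA⟩
  rintro ⟨x, v⟩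
  -- With a section s through the vector, continuity is tested against s in the source and Vs in the
  -- target, where the bound by ‖V‖ suffices.
  obtain ⟨s, rfl⟩ := Section0.exists_apply_eq x v
  have h0 : Tendsto (fun a : E.Total => (⟨a.proj, a.snd⟩ : E.Total)) (𝓝 ⟨x, s x⟩)
    (𝓝 ⟨x, s x⟩) := tendsto_id
  have h1 := (tendsto_iff_of_continuousAt (s.tendsto x)).1 h0
  have h2 : Tendsto (fun a : E.Total => (⟨a.proj, A a.proj a.snd⟩ : F.Total)) (𝓝 ⟨x, s x⟩)
      (𝓝 ⟨x, V s x⟩) := by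
    refine (tendsto_iff_of_continuousAt ((V s).tendsto x)).2 ⟨h1.1, ?_⟩
    refine squeeze_zero (fun _ => norm_nonneg _) (fun a => ?_)
      (by simpa using h1.2.const_mul ‖V‖)
    rw [← hA s a.proj, ← map_sub]
    exact hA' _ _
  rw [← hA s x] at h2
  exact h2

end BanachBundle

open BanachBundle

variable {𝕜 : Type k} [RCLike 𝕜] {Ω : Type u} [TopologicalSpace Ω] [T2Space Ω]
    [LocallyCompactSpace Ω] {G : Type w} [Group G] [TopologicalSpace G]
    [MulAction G Ω] [ContinuousConstSMul G Ω] {S : Submonoid G}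

instance faithful_sectionFunctor : (sectionFunctor.{u, v} 𝕜 Ω S).Faithful where
  map_injective {E F Θ Ξ} h := by
    refine DynBundle.Hom.ext (Morphism.ext fun x v => ?_)
    obtain ⟨s, rfl⟩ := Section0.exists_apply_eq x v
    have h1 : Θ.toMorphism.sectionMap = Ξ.toMorphism.sectionMap :=
      congrArg PreDynModule.Hom.toCLM h
    have h2 := congrArg (fun V : E.bundle.Section0 →L[𝕜] F.bundle.Section0 => V s x) h1
    exact h2

instance full_sectionFunctor : (sectionFunctor.{u, v} 𝕜 Ω S).Full where
  map_surjective {E F} V := by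
    let W : E.bundle.Section0 →L[𝕜] F.bundle.Section0 := V.toCLM
    obtain ⟨Θ, hΘ⟩ := exists_morphism_apply_eq W V.map_act
    have hW : ∀ (s : E.bundle.Section0) (x : Ω),
        Θ.onTotal (⟨x, s x⟩ : E.bundle.Total) = ⟨x, W s x⟩ := fun s x =>
      congrArg (fun v => (⟨x, v⟩ : F.bundle.Total)) (hΘ s x)
    have hkoop : ∀ (g : S) (s : E.bundle.Section0), W (E.koop g s) = F.koop g (W s) :=
      V.intertwines
    refine ⟨⟨Θ, fun g v => ?_⟩, PreDynModule.Hom.ext (ContinuousLinearMap.ext fun s => ?_)⟩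
    · obtain ⟨x, v⟩ := v
      obtain ⟨s, rfl⟩ := Section0.exists_apply_eq x v
      -- Φ_g(s(x)) is the value of the transported section at gx, so intertwining on sections gives
      -- intertwining on vectors.
      rw [← E.mk_koop_smul, hW, hW, hkoop, F.mk_koop_smul]
    · exact Section0.ext fun x => hΘ s x

end FullyFaithful

/-! ### Banach bundles from fields of Banach spaces -/

section FieldBundle

open Filter

namespace BanachField

variable {𝕜 : Type k} [RCLike 𝕜] {Ω : Type u} [TopologicalSpace Ω] {fib : Ω → Type v}
  [∀ x, NormedAddCommGroup (fib x)] [∀ x, NormedSpace 𝕜 (fib x)]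
  {Γ : Type*} [AddCommGroup Γ] [Module 𝕜 Γ]

/-- The topology on the disjoint union of a field of Banach spaces whose neighbourhoods are the
tubes around the sections `x ↦ ev x s`. -/
@[reducible]
def topology (ev : ∀ x, Γ →ₗ[𝕜] fib x) :
    TopologicalSpace (Bundle.TotalSpace PUnit.{1} fib) where
  -- Requiring a tube around every s through v makes the topology axioms formal; upper
  -- semicontinuity is needed only to show that tubes are open.
  IsOpen W := ∀ v ∈ W, ∀ s, ev v.proj s = v.snd → ∃ ε > (0 : ℝ), ∀ᶠ y in 𝓝 v.proj,
    ∀ w : fib y, ‖w - ev y s‖ < ε → (⟨y, w⟩ : Bundle.TotalSpace PUnit.{1} fib) ∈ W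
  isOpen_univ := fun _ _ _ _ => ⟨1, one_pos, .of_forall fun _ _ _ => trivial⟩
  isOpen_inter := by
    rintro W W' hW hW' v ⟨hv, hv'⟩ s hs
    obtain ⟨ε, hε, h⟩ := hW v hv s hs
    obtain ⟨ε', hε', h'⟩ := hW' v hv' s hs
    refine ⟨min ε ε', lt_min hε hε', ?_⟩
    filter_upwards [h, h'] with y h1 h2 w hw
    exact ⟨h1 w (hw.trans_le (min_le_left _ _)), h2 w (hw.trans_le (min_le_right _ _))⟩
  isOpen_sUnion := by
    rintro T hT v ⟨W, hW, hv⟩ s hs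
    obtain ⟨ε, hε, h⟩ := hT W hW v hv s hs
    exact ⟨ε, hε, h.mono fun y hy w hw => ⟨W, hW, hy w hw⟩⟩

variable {ev : ∀ x, Γ →ₗ[𝕜] fib x}

theorem continuous_proj : Continuous[topology ev, _]
    (Bundle.TotalSpace.proj : Bundle.TotalSpace PUnit.{1} fib → Ω) := by
  let := topology ev
  refine continuous_def.2 fun U hU v hv s _ => ⟨1, one_pos, ?_⟩
  filter_upwards [hU.mem_nhds hv] with y hy w _ using hy

/-- If t passes through a point of the tube around s, upper semicontinuity keeps t − s below some ρ
< r nearby, which leaves room r − ρ around t. -/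
theorem isOpen_tube (husc : ∀ s, UpperSemicontinuous fun x => ‖ev x s‖) (s : Γ) (r : ℝ) :
    IsOpen[topology ev]
      {v : Bundle.TotalSpace PUnit.{1} fib | ‖v.snd - ev v.proj s‖ < r} := by
  rintro ⟨x, v⟩ (hv : ‖v - ev x s‖ < r) t (rfl : ev x t = v)
  rw [← map_sub] at hv
  obtain ⟨ρ, hρ, hρr⟩ := exists_between hv
  refine ⟨r - ρ, sub_pos.2 hρr, ?_⟩
  filter_upwards [husc (t - s) x ρ hρ] with y hy w hw
  change ‖w - ev y s‖ < r
  have h1 : w - ev y s = (w - ev y t) + ev y (t - s) := by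
    rw [map_sub]
    abel
  rw [h1]
  exact (norm_add_le _ _).trans_lt (by linarith)

/-- Tubes around a single s through the limit already determine its neighbourhoods. This reduces
most of the bundle axioms to norm estimates. -/
theorem tendsto_nhds_iff (husc : ∀ s, UpperSemicontinuous fun x => ‖ev x s‖) {X : Type*}
    {F : Filter X}
    {a : X → Bundle.TotalSpace PUnit.{1} fib} {x : Ω} {s : Γ} :
    Tendsto a F (@nhds _ (topology ev) ⟨x, ev x s⟩) ↔
      Tendsto (fun i => (a i).proj) F (𝓝 x) ∧
        Tendsto (fun i => ‖(a i).snd - ev (a i).proj s‖) F (𝓝 0) := by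
  let := topology ev
  constructor
  · intro h
    refine ⟨(continuous_proj.tendsto _).comp h, tendsto_order.2 ⟨fun r hr =>
      .of_forall fun _ => hr.trans_le (norm_nonneg _), fun r hr => ?_⟩⟩
    exact h ((isOpen_tube husc s r).mem_nhds (by simpa using hr))
  · rintro ⟨h1, h2⟩ N hN
    obtain ⟨W, hWN, hW, hxW⟩ := mem_nhds_iff.1 hN
    obtain ⟨ε, hε, h⟩ := hW _ hxW s rfl
    rw [mem_map]
    filter_upwards [h1.eventually h, h2.eventually (gt_mem_nhds hε)] with i h3 h4
    exact hWN (h3 _ h4)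

/-- A field of Banach spaces with enough sections of upper semicontinuous norm is a Banach
bundle. -/
def bundle [∀ x, CompleteSpace (fib x)] (ev : ∀ x, Γ →ₗ[𝕜] fib x)
    (hsurj : ∀ x, Function.Surjective (ev x))
    (husc : ∀ s, UpperSemicontinuous fun x => ‖ev x s‖) : BanachBundle.{u, v} 𝕜 Ω :=
  letI := topology ev
  { fiber := fib
    continuous_proj := continuous_proj
    isOpenMap_proj := by
      intro W hW
      refine isOpen_iff_mem_nhds.2 ?_
      rintro _ ⟨⟨x, v⟩, hv, rfl⟩
      obtain ⟨s, hs⟩ := hsurj x v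
      obtain ⟨ε, hε, h⟩ := hW _ hv s hs
      filter_upwards [h] with y hy
      exact ⟨⟨y, ev y s⟩, hy _ (by simpa using hε), rfl⟩
    continuous_add := by
      refine continuous_iff_continuousAt.2 ?_
      rintro ⟨⟨⟨x, v⟩, ⟨y, w⟩⟩, (rfl : x = y)⟩
      obtain ⟨s, rfl⟩ := hsurj x v
      obtain ⟨t, rfl⟩ := hsurj x w
      rw [ContinuousAt, ← map_add]
      have h1 := (tendsto_nhds_iff husc).1 ((continuous_fst.comp
        continuous_subtype_val).tendsto (⟨(⟨x, ev x s⟩, ⟨x, ev x t⟩), rfl⟩ :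
          {q : Bundle.TotalSpace PUnit.{1} fib × Bundle.TotalSpace PUnit.{1} fib //
            q.1.proj = q.2.proj}))
      have h2 := (tendsto_nhds_iff husc).1 ((continuous_snd.comp
        continuous_subtype_val).tendsto (⟨(⟨x, ev x s⟩, ⟨x, ev x t⟩), rfl⟩ :
          {q : Bundle.TotalSpace PUnit.{1} fib × Bundle.TotalSpace PUnit.{1} fib //
            q.1.proj = q.2.proj}))
      refine (tendsto_nhds_iff husc).2 ⟨h2.1, ?_⟩
      refine squeeze_zero (fun _ => norm_nonneg _) ?_ (by simpa using h1.2.add h2.2)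
      rintro ⟨⟨⟨y, v⟩, ⟨z, w⟩⟩, (rfl : y = z)⟩
      change ‖v + w - ev y (s + t)‖ ≤ ‖v - ev y s‖ + ‖w - ev y t‖
      rw [map_add, add_sub_add_comm]
      exact norm_add_le _ _
    continuous_smul := by
      refine continuous_iff_continuousAt.2 ?_
      rintro ⟨c, ⟨x, v⟩⟩
      obtain ⟨s, rfl⟩ := hsurj x v
      rw [ContinuousAt, ← map_smul]
      have h1 := (tendsto_nhds_iff husc).1 (continuous_snd.tendsto
        ((c, ⟨x, ev x s⟩) : 𝕜 × Bundle.TotalSpace PUnit.{1} fib))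
      have h2 : Tendsto (fun q : 𝕜 × Bundle.TotalSpace PUnit.{1} fib => q.1)
        (𝓝 (c, ⟨x, ev x s⟩)) (𝓝 c) := continuous_fst.tendsto _
      refine (tendsto_nhds_iff husc).2 ⟨h1.1, ?_⟩
      -- The norm of s need not be continuous, but upper semicontinuity bounds it near x.
      have h3 : ∀ᶠ q in 𝓝 ((c, ⟨x, ev x s⟩) : 𝕜 × Bundle.TotalSpace PUnit.{1} fib),
          ‖ev q.2.proj s‖ ≤ ‖ev x s‖ + 1 :=
        (h1.1.eventually (husc s x _ (lt_add_one _))).mono fun q hq => le_of_lt hq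
      have h4 : Tendsto (fun q : 𝕜 × Bundle.TotalSpace PUnit.{1} fib =>
          ‖q.1‖ * ‖q.2.snd - ev q.2.proj s‖ + ‖q.1 - c‖ * (‖ev x s‖ + 1))
          (𝓝 (c, ⟨x, ev x s⟩)) (𝓝 0) := by
        simpa using (h2.norm.mul h1.2).add (((h2.sub_const c).norm).mul_const (‖ev x s‖ + 1))
      refine squeeze_zero' (.of_forall fun _ => norm_nonneg _) ?_ h4
      filter_upwards [h3] with q hq
      have h5 : q.1 • q.2.snd - ev q.2.proj (c • s) =
          q.1 • (q.2.snd - ev q.2.proj s) + (q.1 - c) • ev q.2.proj s := by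
        rw [map_smul, smul_sub, sub_smul]
        abel
      change ‖q.1 • q.2.snd - ev q.2.proj (c • s)‖ ≤ _
      rw [h5]
      refine (norm_add_le _ _).trans ?_
      rw [norm_smul, norm_smul]
      gcongr
    upperSemicontinuous_norm := by
      rintro ⟨x, v⟩ r hr
      obtain ⟨s, rfl⟩ := hsurj x v
      obtain ⟨ρ, hρ, hρr⟩ := exists_between hr
      have h1 := (tendsto_nhds_iff husc).1 (tendsto_id (x := 𝓝
        (⟨x, ev x s⟩ : Bundle.TotalSpace PUnit.{1} fib)))
      filter_upwards [h1.1.eventually (husc s x ρ hρ),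
        h1.2.eventually (gt_mem_nhds (sub_pos.2 hρr))] with a h2 h3
      have h4 := norm_add_le (a.snd - ev a.proj s) (ev a.proj s)
      rw [sub_add_cancel] at h4
      have h5 : ‖a.snd - ev a.proj s‖ < r - ρ := h3
      have h6 : ‖ev a.proj s‖ < ρ := h2
      linarith
    zero_nhds := by
      intro x W hW hxW
      obtain ⟨ε, hε, h⟩ := hW _ hxW 0 (map_zero _)
      obtain ⟨U, hUh, hU, hxU⟩ := mem_nhds_iff.1 h
      refine ⟨ε / 2, half_pos hε, U, hU, hxU, fun v hv hv' => hUh hv v.snd ?_⟩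
      rw [map_zero, sub_zero]
      linarith }

end BanachField

end FieldBundle

/-! ### Fibres of a module and localization of the norm -/

section ModuleFibers

open Filter ZeroAtInftyContinuousMap

variable {𝕜 : Type k} [RCLike 𝕜] {Ω : Type u} [TopologicalSpace Ω] {G : Type w} [Group G]
  {S : Submonoid G}

namespace PreDynModule

/-- The closed submodule of the elements of `M` vanishing at `x`. -/
def vanishing (M : PreDynModule.{u, v} 𝕜 Ω S) (x : Ω) : Submodule 𝕜 M.carrier :=
  (Submodule.span 𝕜
    {t | ∃ (f : C₀(Ω, 𝕜)) (s : M.carrier), f x = 0 ∧ t = M.act f s}).topologicalClosure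

instance (M : PreDynModule.{u, v} 𝕜 Ω S) (x : Ω) : IsClosed (M.vanishing x : Set M.carrier) :=
  Submodule.isClosed_topologicalClosure _

/-- The fibre of `M` at `x`. -/
abbrev Fiber (M : PreDynModule.{u, v} 𝕜 Ω S) (x : Ω) : Type v := M.carrier ⧸ M.vanishing x

/-- The value at `x` of an element of `M`. -/
abbrev ev (M : PreDynModule.{u, v} 𝕜 Ω S) (x : Ω) : M.carrier →ₗ[𝕜] M.Fiber x :=
  (M.vanishing x).mkQ

variable {M : PreDynModule.{u, v} 𝕜 Ω S}

theorem ev_surjective (x : Ω) : Function.Surjective (M.ev x) := Submodule.mkQ_surjective _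

theorem ev_eq_zero_iff {x : Ω} {s : M.carrier} : M.ev x s = 0 ↔ s ∈ M.vanishing x := by
  simp

theorem norm_ev_le (x : Ω) (s : M.carrier) : ‖M.ev x s‖ ≤ ‖s‖ := Submodule.Quotient.norm_mk_le _ s

theorem exists_ev_eq_norm_lt {x : Ω} {v : M.Fiber x} {c : ℝ} (h : ‖v‖ < c) :
    ∃ s, M.ev x s = v ∧ ‖s‖ < c := by
  obtain ⟨s, hs, hsc⟩ := Submodule.Quotient.norm_mk_lt v (sub_pos.2 h)
  exact ⟨s, hs, by linarith⟩

namespace IsBanachModule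

theorem exists_cutoff_norm_act_sub_le [T2Space Ω] [LocallyCompactSpace Ω]
    (hM : M.IsBanachModule) (s : M.carrier) (K : Set Ω) (hK : IsCompact K) {ε : ℝ}
    (hε : 0 < ε) :
    ∃ (χ : C(Ω, ℝ)) (hχ : HasCompactSupport χ), (∀ x, 0 ≤ χ x ∧ χ x ≤ 1) ∧ (∀ x ∈ K, χ x = 1) ∧
      ‖M.act (ofCompactSupport 𝕜 χ hχ) s - s‖ ≤ ε := by
  obtain ⟨L, hL, h⟩ := hM.exists_compact_approx_unit s hε
  obtain ⟨χ, h1, -, h2, hχ⟩ := exists_cutoff (hK.union hL) isOpen_univ (Set.subset_univ _)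
  refine ⟨χ, hχ, h2, fun x hx => h1 x (Or.inl hx), h _ (fun x => ?_) fun x hx => ?_⟩
  · rw [ofCompactSupport_apply, RCLike.norm_ofReal, abs_of_nonneg (h2 x).1]
    exact (h2 x).2
  · simp [h1 x (Or.inr hx)]

theorem ev_act_of_eq_zero {f : C₀(Ω, 𝕜)} {x : Ω} (hf : f x = 0) (s : M.carrier) :
    M.ev x (M.act f s) = 0 :=
  ev_eq_zero_iff.2 (Submodule.le_topologicalClosure _ (Submodule.subset_span ⟨f, s, hf, rfl⟩))

/-- For a cutoff χ with χ(x) = 1 and χs close to s, the function f − f(x)χ vanishes at x, so fs and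
f(x)s agree at x up to a small error. -/
theorem ev_act [T2Space Ω] [LocallyCompactSpace Ω] (hM : M.IsBanachModule) (f : C₀(Ω, 𝕜))
    (s : M.carrier) (x : Ω) : M.ev x (M.act f s) = f x • M.ev x s := by
  rw [← sub_eq_zero, ← map_smul, ← map_sub, ← norm_le_zero_iff]
  refine le_of_forall_pos_le_add fun ε hε => ?_
  obtain ⟨χ, hχ, -, h1, h⟩ := hM.exists_cutoff_norm_act_sub_le s {x} isCompact_singleton
    (show 0 < ε / (‖f x‖ + 1) by positivity)
  have h2 : M.act f s - f x • s = M.act (f - f x • ofCompactSupport 𝕜 χ hχ) s +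
      f x • (M.act (ofCompactSupport 𝕜 χ hχ) s - s) := by
    rw [map_sub, map_smul, LinearMap.sub_apply, LinearMap.smul_apply, smul_sub]
    abel
  rw [h2, map_add, ev_act_of_eq_zero (by simp [h1 x rfl]), zero_add, zero_add]
  refine (norm_ev_le _ _).trans ?_
  rw [norm_smul]
  rw [le_div_iff₀ (by positivity)] at h
  nlinarith [norm_nonneg (M.act (ofCompactSupport 𝕜 χ hχ) s - s)]

/-- If f(x) = 0, then ef is small as soon as e lives where |f| is small; finite combinations inherit
this. -/
theorem exists_nhds_norm_act_le (hM : M.IsBanachModule) {x : Ω} {s : M.carrier}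
    (hs : s ∈ Submodule.span 𝕜
      {t | ∃ (f : C₀(Ω, 𝕜)) (s : M.carrier), f x = 0 ∧ t = M.act f s}) :
    ∀ ε > 0, ∃ U ∈ 𝓝 x, ∀ e : C₀(Ω, 𝕜), (∀ y, ‖e y‖ ≤ 1) → (∀ y ∉ U, e y = 0) →
      ‖M.act e s‖ ≤ ε := by
  induction hs using Submodule.span_induction with
  | mem t ht =>
    obtain ⟨f, s, hf, rfl⟩ := ht
    intro ε hε
    have hδ : 0 < ε / (‖s‖ + 1) := by positivity
    refine ⟨{y | ‖f y‖ < ε / (‖s‖ + 1)}, ?_, fun e he heU => ?_⟩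
    · refine ((map_continuous f).norm.tendsto x).eventually (gt_mem_nhds ?_)
      rwa [hf, norm_zero]
    · rw [← hM.mul_act]
      have h1 : ‖e * f‖ ≤ ε / (‖s‖ + 1) := norm_le_of_forall hδ.le fun y => by
        have h2 : (e * f) y = e y * f y := rfl
        rw [h2]
        by_cases hy : ‖f y‖ < ε / (‖s‖ + 1)
        · rw [norm_mul]
          exact (mul_le_of_le_one_left (norm_nonneg _) (he y)).trans hy.le
        · rw [heU y hy, zero_mul, norm_zero]
          exact hδ.le
      refine (hM.norm_act_le _ _).trans ((mul_le_mul_of_nonneg_right h1 (norm_nonneg _)).trans ?_)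
      rw [div_mul_eq_mul_div, div_le_iff₀ (by positivity)]
      nlinarith [norm_nonneg s]
  | zero => exact fun ε hε => ⟨Set.univ, univ_mem, fun e _ _ => by simpa using hε.le⟩
  | add t u _ _ iht ihu =>
    intro ε hε
    obtain ⟨U, hU, h⟩ := iht (ε / 2) (half_pos hε)
    obtain ⟨U', hU', h'⟩ := ihu (ε / 2) (half_pos hε)
    refine ⟨U ∩ U', inter_mem hU hU', fun e he heU => ?_⟩
    rw [map_add]
    refine (norm_add_le _ _).trans ?_
    linarith [h e he fun y hy => heU y fun hy' => hy hy'.1,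
      h' e he fun y hy => heU y fun hy' => hy hy'.2]
  | smul c t _ iht =>
    intro ε hε
    obtain ⟨U, hU, h⟩ := iht (ε / (‖c‖ + 1)) (by positivity)
    refine ⟨U, hU, fun e he heU => ?_⟩
    have h1 := h e he heU
    rw [map_smul, norm_smul]
    rw [le_div_iff₀ (by positivity)] at h1
    nlinarith [norm_nonneg (M.act e t)]

variable [T2Space Ω] [LocallyCompactSpace Ω]

/-- Localization of the norm: an element of small norm in the fibre at `x` becomes small upon
multiplication by a suitable cutoff function. -/
theorem exists_cutoff_norm_act_lt (hM : M.IsBanachModule) {s : M.carrier} {x : Ω} {c : ℝ}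
    (hc : ‖M.ev x s‖ < c) :
    ∃ (χ : C(Ω, ℝ)) (hχ : HasCompactSupport χ) (U : Set Ω), (∀ y, 0 ≤ χ y ∧ χ y ≤ 1) ∧
      IsOpen U ∧ x ∈ U ∧ (∀ y ∈ U, χ y = 1) ∧ ‖M.act (ofCompactSupport 𝕜 χ hχ) s‖ < c := by
  obtain ⟨m, hm, hmc⟩ := exists_ev_eq_norm_lt hc
  -- s is split into a short representative m of its class, an element j that the cutoff makes
  -- smaller than δ, and a remainder below δ; the sum stays below ‖m‖ + 3δ = c.
  have hδ : 0 < (c - ‖m‖) / 3 := by linarith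
  have hsm : s - m ∈ M.vanishing x := by
    rw [← ev_eq_zero_iff, map_sub, hm, sub_self]
  obtain ⟨j, hj, hjs⟩ := Metric.mem_closure_iff.1 hsm _ hδ
  obtain ⟨W, hW, hWj⟩ := hM.exists_nhds_norm_act_le hj _ hδ
  obtain ⟨L, hL, hLW, hLc⟩ := local_compact_nhds (interior_mem_nhds.2 hW)
  obtain ⟨χ, h1, h2, h3, hχ⟩ := exists_cutoff hLc isOpen_interior hLW
  refine ⟨χ, hχ, interior L, h3, isOpen_interior, mem_interior_iff_mem_nhds.2 hL,
    fun y hy => h1 y (interior_subset hy), ?_⟩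
  have hχ1 : ∀ y, ‖ofCompactSupport 𝕜 χ hχ y‖ ≤ 1 := fun y => by
    rw [ofCompactSupport_apply, RCLike.norm_ofReal, abs_of_nonneg (h3 y).1]
    exact (h3 y).2
  have hcon : ∀ t, ‖M.act (ofCompactSupport 𝕜 χ hχ) t‖ ≤ ‖t‖ := fun t =>
    (hM.norm_act_le _ _).trans
      (mul_le_of_le_one_left (norm_nonneg _) (norm_le_of_forall zero_le_one hχ1))
  have h4 := hWj (ofCompactSupport 𝕜 χ hχ) hχ1 fun y hy => by
    rw [ofCompactSupport_apply, image_eq_zero_of_notMem_tsupport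
      fun hy' => hy (interior_subset (h2 hy')), RCLike.ofReal_zero]
  have h5 : s = m + j + (s - m - j) := by abel
  rw [dist_eq_norm] at hjs
  rw [h5, map_add, map_add]
  refine norm_add₃_le.trans_lt ?_
  linarith [hcon m, hcon (s - m - j)]

/-- The localizing cutoff is 1 near x, so it does not change the values there, and these are bounded
by the global norm of the cut-off element. -/
theorem upperSemicontinuous_norm_ev (hM : M.IsBanachModule) (s : M.carrier) :
    UpperSemicontinuous fun x => ‖M.ev x s‖ := by
  intro x c hc
  obtain ⟨χ, hχ, U, -, hU, hxU, h1, h⟩ := hM.exists_cutoff_norm_act_lt hc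
  filter_upwards [hU.mem_nhds hxU] with y hy
  have h2 : M.ev y (M.act (ofCompactSupport 𝕜 χ hχ) s) = M.ev y s := by
    simp [hM.ev_act, h1 y hy]
  rw [← h2]
  exact (norm_ev_le _ _).trans_lt h

theorem norm_ev_vanishesAtInfty (hM : M.IsBanachModule) (s : M.carrier) {ε : ℝ} (hε : 0 < ε) :
    ∃ K : Set Ω, IsCompact K ∧ ∀ x ∉ K, ‖M.ev x s‖ ≤ ε := by
  obtain ⟨χ, hχ, -, -, h⟩ := hM.exists_cutoff_norm_act_sub_le s ∅ isCompact_empty hε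
  refine ⟨tsupport χ, hχ, fun x hx => ?_⟩
  have h1 : M.ev x (M.act (ofCompactSupport 𝕜 χ hχ) s - s) = - M.ev x s := by
    rw [map_sub, ev_act_of_eq_zero, zero_sub]
    simp [image_eq_zero_of_notMem_tsupport hx]
  rw [← norm_neg, ← h1]
  exact (norm_ev_le _ _).trans h

/-- The norm of an AM-module is the supremum of the norms in the fibres. -/
theorem norm_le_of_forall_norm_ev_le (hM : M.IsBanachModule) {s : M.carrier}
    (hs : M.IsCyclicAMSpace s) {C : ℝ} (hC : 0 ≤ C) (h : ∀ x, ‖M.ev x s‖ ≤ C) : ‖s‖ ≤ C := by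
  refine le_of_forall_pos_le_add fun ε hε => ?_
  obtain ⟨χ, hχ, h0, -, he⟩ :=
    hM.exists_cutoff_norm_act_sub_le s ∅ isCompact_empty (half_pos hε)
  obtain ⟨m, hm, hmc, hmχ⟩ : ∃ m : C₀(Ω, 𝕜), m.IsPos ∧ ‖M.act m s‖ ≤ C + ε / 2 ∧
      ∀ y ∈ tsupport χ, 1 ≤ RCLike.re (m y) := by
    -- The AM condition is what lets local cutoffs be joined by maxima without losing the bound C +
    -- ε/2; a sum of cutoffs would lose it.
    refine IsCompact.induction_on (p := fun A => ∃ m : C₀(Ω, 𝕜), m.IsPos ∧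
      ‖M.act m s‖ ≤ C + ε / 2 ∧ ∀ y ∈ A, 1 ≤ RCLike.re (m y)) hχ ?_ ?_ ?_ ?_
    · refine ⟨0, fun x => by simp, ?_, fun y hy => hy.elim⟩
      rw [map_zero, LinearMap.zero_apply, norm_zero]
      positivity
    · rintro A B hAB ⟨m, h1, h2, h3⟩
      exact ⟨m, h1, h2, fun y hy => h3 y (hAB hy)⟩
    · rintro A B ⟨m, h1, h2, h3⟩ ⟨m', h1', h2', h3'⟩
      refine ⟨m.reMax m', h1.reMax,
        ((hM.isCyclicAMSpace_iff s).1 hs m m' h1 h1').trans (max_le h2 h2'), ?_⟩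
      rintro y (hy | hy)
      · simp [h3 y hy]
      · simp [h3' y hy]
    · intro x _
      obtain ⟨η, hη, U, h1, hU, hxU, h2, h3⟩ := hM.exists_cutoff_norm_act_lt
        ((h x).trans_lt (by linarith : C < C + ε / 2))
      exact ⟨U, mem_nhdsWithin_of_mem_nhds (hU.mem_nhds hxU), ofCompactSupport 𝕜 η hη,
        fun y => by simp [h1 y], h3.le, fun y hy => by simp [h2 y hy]⟩
  have h1 : ‖M.act (ofCompactSupport 𝕜 χ hχ) s‖ ≤ ‖M.act m s‖ := by
    refine hM.norm_act_le_norm_act (fun y => ?_) s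
    rw [hm.norm_apply, ofCompactSupport_apply, RCLike.norm_ofReal, abs_of_nonneg (h0 y).1]
    by_cases hy : y ∈ tsupport χ
    · exact (h0 y).2.trans (hmχ y hy)
    · rw [image_eq_zero_of_notMem_tsupport hy]
      exact (hm y).1
  have h2 := norm_sub_le (M.act (ofCompactSupport 𝕜 χ hχ) s)
    (M.act (ofCompactSupport 𝕜 χ hχ) s - s)
  rw [sub_sub_cancel] at h2
  linarith

end IsBanachModule

end PreDynModule

end ModuleFibers

/-! ### Reconstruction of the dynamical bundle from a dynamical AM-module -/

section Reconstruction

open Filter ZeroAtInftyContinuousMap BanachBundle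

namespace PreDynModule

variable {𝕜 : Type k} [RCLike 𝕜] {Ω : Type u} [TopologicalSpace Ω] {G : Type w} [Group G]
  {S : Submonoid G} {M : PreDynModule.{u, v} 𝕜 Ω S}

namespace IsDynamical

variable [TopologicalSpace G] [MulAction G Ω] [ContinuousConstSMul G Ω]

/-- If f vanishes at x, then T_φ(g)f vanishes at gx. -/
theorem vanishing_le_comap (hM : M.IsDynamical) (g : S) (x : Ω) :
    M.vanishing x ≤ (M.vanishing ((g : G) • x)).comap (M.op g : M.carrier →ₗ[𝕜] M.carrier) := by
  refine Submodule.topologicalClosure_minimal _ (Submodule.span_le.2 ?_)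
    ((Submodule.isClosed_topologicalClosure _).preimage (M.op g).continuous)
  rintro _ ⟨f, s, hf, rfl⟩
  refine ev_eq_zero_iff.1 (?_ : M.ev _ (M.op g (M.act f s)) = 0)
  rw [hM.op_act]
  refine IsBanachModule.ev_act_of_eq_zero ?_ _
  change f ((g : G)⁻¹ • (g : G) • x) = 0
  rwa [inv_smul_smul]

/-- The operators induced by the dynamics on the fibres. -/
noncomputable def fiberMap (hM : M.IsDynamical) (g : S) (x : Ω) :
    M.Fiber x →L[𝕜] M.Fiber ((g : G) • x) :=
  LinearMap.mkContinuous
    ((M.vanishing x).mapQ _ (M.op g : M.carrier →ₗ[𝕜] M.carrier) (hM.vanishing_le_comap g x))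
    ‖M.op g‖ fun v => by
      have h1 : Tendsto (fun c : ℝ => ‖M.op g‖ * c) (𝓝[>] ‖v‖) (𝓝 (‖M.op g‖ * ‖v‖)) :=
        ((continuous_const.mul continuous_id).tendsto _).mono_left nhdsWithin_le_nhds
      refine ge_of_tendsto h1 (eventually_nhdsWithin_of_forall fun c hc => ?_)
      obtain ⟨s, rfl, hs⟩ := exists_ev_eq_norm_lt hc
      exact (norm_ev_le _ (M.op g s)).trans (((M.op g).le_opNorm s).trans
        (mul_le_mul_of_nonneg_left hs.le (norm_nonneg _)))

theorem fiberMap_ev (hM : M.IsDynamical) (g : S) (x : Ω) (s : M.carrier) :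
    hM.fiberMap g x (M.ev x s) = M.ev ((g : G) • x) (M.op g s) := rfl

theorem norm_fiberMap_le (hM : M.IsDynamical) (g : S) (x : Ω) : ‖hM.fiberMap g x‖ ≤ ‖M.op g‖ :=
  LinearMap.mkContinuous_norm_le _ (norm_nonneg _) _

/-- Strong continuity bounds each orbit over K, and Banach–Steinhaus makes the bound uniform. -/
theorem exists_norm_op_le (hM : M.IsDynamical) {K : Set S} (hK : IsCompact K) :
    ∃ C : ℝ, ∀ g ∈ K, ‖M.op g‖ ≤ C := by
  have := hM.complete
  obtain ⟨C, hC⟩ := banach_steinhaus (g := fun g : K => M.op g) fun s => by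
    obtain ⟨C, hC⟩ := hK.exists_bound_of_continuousOn (hM.strongly_continuous s).continuousOn
    exact ⟨C, fun g => hC g g.2⟩
  exact ⟨C, fun g hg => hC ⟨g, hg⟩⟩

end IsDynamical

variable [T2Space Ω] [LocallyCompactSpace Ω]

namespace IsBanachModule

/-- The bundle with the fibres `M.Fiber x` whose topology is determined by `M`. -/
noncomputable def bundle (hM : M.IsBanachModule) : BanachBundle.{u, v} 𝕜 Ω :=
  have := hM.complete
  BanachField.bundle M.ev ev_surjective hM.upperSemicontinuous_norm_ev

variable (hM : M.IsBanachModule)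

theorem tendsto_bundle_iff {X : Type*} {F : Filter X} {b : X → Ω} {v : ∀ a, M.Fiber (b a)} {x : Ω}
    {s : M.carrier} :
    Tendsto (fun a => (⟨b a, v a⟩ : hM.bundle.Total)) F (𝓝 ⟨x, M.ev x s⟩) ↔
      Tendsto b F (𝓝 x) ∧ Tendsto (fun a => ‖v a - M.ev (b a) s‖) F (𝓝 0) :=
  BanachField.tendsto_nhds_iff hM.upperSemicontinuous_norm_ev

/-- The section `x ↦ M.ev x s`. -/
noncomputable def toSection (s : M.carrier) : hM.bundle.Section0 :=
  ⟨fun x => M.ev x s, continuous_iff_continuousAt.2 fun x =>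
    hM.tendsto_bundle_iff.2 ⟨tendsto_id, by simp⟩,
    fun _ hε => hM.norm_ev_vanishesAtInfty s hε⟩

theorem toSection_act (f : C₀(Ω, 𝕜)) (s : M.carrier) :
    hM.toSection (M.act f s) = Section0.act _ f (hM.toSection s) :=
  Section0.ext fun x => hM.ev_act f s x

/-- An AM-module embeds isometrically into the space of sections of its bundle. -/
noncomputable def toSectionIsometry (ham : ∀ s, M.IsCyclicAMSpace s) :
    M.carrier →ₗᵢ[𝕜] hM.bundle.Section0 where
  toFun := hM.toSection
  map_add' s t := Section0.ext fun x => map_add (M.ev x) s t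
  map_smul' c s := Section0.ext fun x => map_smul (M.ev x) c s
  norm_map' s := le_antisymm
    (Section0.norm_le_of (norm_nonneg _) fun x => norm_ev_le x s)
    (hM.norm_le_of_forall_norm_ev_le (ham s) (norm_nonneg _) (hM.toSection s).norm_apply_le)

/-- The range is closed, as the isometric image of a complete space. It is dense because a section
is matched at each point by an element of M, hence nearly so in a neighbourhood, and the local
matches are glued by a partition of unity. -/
theorem toSectionIsometry_surjective (ham : ∀ s, M.IsCyclicAMSpace s) :
    Function.Surjective (hM.toSectionIsometry ham) := by
  have := hM.complete
  rw [← Set.range_eq_univ,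
    ← (hM.toSectionIsometry ham).isometry.isClosedEmbedding.isClosed_range.closure_eq]
  refine Set.eq_univ_iff_forall.2 fun σ => Metric.mem_closure_iff.2 fun ε hε => ?_
  have hε3 : 0 < ε / 3 := by linarith
  obtain ⟨χ, hχ, h0, h⟩ := σ.exists_norm_act_cutoff_sub_le hε3
  choose s hs using fun x => ev_surjective (M := M) x (σ x)
  obtain ⟨n, y, ρ, -, hρV, hρ1, hρ0, hρ⟩ := exists_finite_partition hχ
    (fun x => {z | ‖(σ - hM.toSection (s x)) z‖ < ε / 3}) fun x _ =>
      ⟨(hM.bundle.upperSemicontinuous_norm.comp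
        (σ - hM.toSection (s x)).continuous).isOpen_preimage _, by
        change ‖σ x - hM.toSection (s x) x‖ < ε / 3
        rw [show hM.toSection (s x) x = σ x from hs x, sub_self, norm_zero]
        exact hε3⟩
  -- The ρ i sum to 1 only on the support of χ; the factor χ removes what is uncontrolled elsewhere.
  let t : M.carrier := M.act (ofCompactSupport 𝕜 χ hχ)
    (∑ i, M.act (ofCompactSupport 𝕜 (ρ i) (hρ i)) (s (y i)))
  have ht : ∀ z, hM.toSection t z =
      (χ z : 𝕜) • ∑ i, (ρ i z : 𝕜) • hM.toSection (s (y i)) z := fun z => by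
    change M.ev z t = (χ z : 𝕜) • ∑ i, (ρ i z : 𝕜) • M.ev z (s (y i))
    simp only [t, hM.ev_act, map_sum, ofCompactSupport_apply, Finset.smul_sum]
  have h1 : ‖hM.toSection t - Section0.act _ (ofCompactSupport 𝕜 χ hχ) σ‖ ≤ ε / 3 := by
    refine Section0.norm_le_of hε3.le fun z => ?_
    rw [Section0.sub_apply, ht, Section0.act_apply, ofCompactSupport_apply, ← smul_sub, norm_smul,
      RCLike.norm_ofReal, abs_of_nonneg (h0 z).1]
    by_cases hz : z ∈ tsupport χ
    · refine (mul_le_of_le_one_left (norm_nonneg _) (h0 z).2).trans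
        (norm_sum_smul_sub_le (fun i => hρ0 i z) (hρ1 z hz) fun i hi => ?_)
      have h2 : ‖σ z - hM.toSection (s (y i)) z‖ < ε / 3 := hρV i (subset_tsupport _ hi)
      rw [norm_sub_rev]
      exact h2.le
    · rw [image_eq_zero_of_notMem_tsupport hz, zero_mul]
      exact hε3.le
  refine ⟨hM.toSection t, ⟨t, rfl⟩, ?_⟩
  rw [dist_comm, dist_eq_norm, ← sub_add_sub_cancel _
    (Section0.act _ (ofCompactSupport 𝕜 χ hχ) σ) σ]
  exact (norm_add_le _ _).trans_lt (by linarith)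

/-- An AM-module is isometrically isomorphic to the space of sections of its bundle. -/
noncomputable def sectionEquiv (ham : ∀ s, M.IsCyclicAMSpace s) :
    M.carrier ≃ₗᵢ[𝕜] hM.bundle.Section0 :=
  LinearIsometryEquiv.ofSurjective (hM.toSectionIsometry ham) (hM.toSectionIsometry_surjective ham)

end IsBanachModule

namespace IsDynamical

variable [TopologicalSpace G] [MulAction G Ω] [ContinuousSMul G Ω]

/-- Near (g₀, s(x)), the error splits into the image of v − s(y), controlled by local boundedness,
and a value of 𝒯(g)s − 𝒯(g₀)s, controlled by strong continuity. -/
theorem continuous_fiberMap [LocallyCompactSpace S] (hM : M.IsDynamical) :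
    Continuous fun q : S × hM.bundle.Total =>
      (⟨(q.1 : G) • q.2.proj, hM.fiberMap q.1 q.2.proj q.2.snd⟩ : hM.bundle.Total) := by
  refine continuous_iff_continuousAt.2 ?_
  rintro ⟨g₀, ⟨x, v⟩⟩
  obtain ⟨s, rfl⟩ := ev_surjective (M := M) x v
  have h1 := hM.tendsto_bundle_iff.1 (continuous_snd.tendsto
    ((g₀, ⟨x, M.ev x s⟩) : S × hM.bundle.Total))
  have h2 : Tendsto (fun q : S × hM.bundle.Total => q.1) (𝓝 (g₀, ⟨x, M.ev x s⟩)) (𝓝 g₀) :=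
    continuous_fst.tendsto _
  obtain ⟨N, hN, hgN⟩ := exists_compact_mem_nhds g₀
  obtain ⟨C, hC⟩ := hM.exists_norm_op_le hN
  have h3 : Tendsto (fun q : S × hM.bundle.Total => ((q.1 : S) : G) • q.2.proj)
      (𝓝 (g₀, ⟨x, M.ev x s⟩)) (𝓝 ((g₀ : G) • x)) :=
    ((continuous_subtype_val.tendsto g₀).comp h2).smul h1.1
  refine hM.tendsto_bundle_iff (s := M.op g₀ s).2 ⟨h3, ?_⟩
  have h4 := (h1.2.const_mul C).add
    ((((hM.strongly_continuous s).tendsto g₀).comp h2).sub_const (M.op g₀ s)).norm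
  rw [sub_self, norm_zero, mul_zero, add_zero] at h4
  refine squeeze_zero' (.of_forall fun _ => norm_nonneg _) ?_ h4
  filter_upwards [h2.eventually hgN] with ⟨g, ⟨y, v⟩⟩ hg
  change M.Fiber y at v
  have h6 : hM.fiberMap g y v - M.ev _ (M.op g₀ s) =
      hM.fiberMap g y (v - M.ev y s) + M.ev _ (M.op g s - M.op g₀ s) := by
    rw [map_sub, fiberMap_ev, map_sub]
    abel
  change ‖hM.fiberMap g y v - M.ev _ (M.op g₀ s)‖ ≤
    C * ‖v - M.ev y s‖ + ‖M.op g s - M.op g₀ s‖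
  rw [h6]
  refine (norm_add_le _ _).trans (add_le_add ?_ (norm_ev_le _ _))
  exact (hM.fiberMap _ _).le_of_opNorm_le ((hM.norm_fiberMap_le _ _).trans (hC _ hg)) _

/-- Stated in the bundle space because fibres over equal points, such as (gh)x and g(hx), are
different types. -/
theorem mk_ev_congr (hM : M.IsDynamical) {x y : Ω} (h : x = y) {s t : M.carrier} (hst : s = t) :
    (⟨x, M.ev x s⟩ : hM.bundle.Total) = ⟨y, M.ev y t⟩ := by
  subst h hst
  rfl

/-- The dynamical Banach bundle of a dynamical module. -/
noncomputable def dynBundle [LocallyCompactSpace S] (hM : M.IsDynamical) :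
    DynBundle.{u, v} 𝕜 Ω S where
  bundle := hM.bundle
  dyn g :=
    { app := hM.fiberMap g
      continuous_total := hM.continuous_fiberMap.comp (continuous_const.prodMk continuous_id)
      bounded := ⟨‖M.op g‖, hM.norm_fiberMap_le g⟩ }
  dyn_one := by
    funext ⟨x, v⟩
    obtain ⟨s, rfl⟩ := ev_surjective (M := M) x v
    exact hM.mk_ev_congr (one_smul G x) (by rw [hM.op_one]; rfl)
  dyn_mul g h := by
    funext ⟨x, v⟩
    obtain ⟨s, rfl⟩ := ev_surjective (M := M) x v
    exact hM.mk_ev_congr (mul_smul (g : G) (h : G) x) (by rw [hM.op_mul]; rfl)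
  jointly_continuous := hM.continuous_fiberMap
  locally_bounded K hK := by
    obtain ⟨C, hC⟩ := hM.exists_norm_op_le hK
    exact ⟨C, fun g hg x => (hM.norm_fiberMap_le g x).trans (hC g hg)⟩

theorem toSection_op [LocallyCompactSpace S] (hM : M.IsDynamical) (g : S) (s : M.carrier) :
    hM.toSection (M.op g s) = hM.dynBundle.koop g (hM.toSection s) := by
  refine Section0.ext_mk fun x => ?_
  refine Eq.trans ?_ (hM.dynBundle.mk_koop g (hM.toSection s) x).symm
  exact hM.mk_ev_congr (smul_inv_smul (g : G) x).symm rfl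

end IsDynamical

/-- A dynamical AM-module is isomorphic to the module of sections of its bundle. -/
noncomputable def IsDynAMModule.iso {M : PreDynModule.{u, max u v} 𝕜 Ω S}
    [TopologicalSpace G] [MulAction G Ω] [ContinuousSMul G Ω]
    [LocallyCompactSpace S] (hM : M.IsDynAMModule) :
    (sectionFunctor.{u, max u v} 𝕜 Ω S).obj hM.dynBundle ≅ M where
  hom :=
    { toCLM := ((hM.sectionEquiv hM.am).symm.toContinuousLinearEquiv :
        hM.bundle.Section0 →L[𝕜] M.carrier)
      map_act := fun f (s : hM.bundle.Section0) => by
        obtain ⟨t, rfl⟩ := (hM.sectionEquiv hM.am).surjective s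
        refine (hM.sectionEquiv hM.am).injective ?_
        change hM.sectionEquiv hM.am ((hM.sectionEquiv hM.am).symm
          (Section0.act _ f (hM.sectionEquiv hM.am t))) = hM.sectionEquiv hM.am
          (M.act f ((hM.sectionEquiv hM.am).symm (hM.sectionEquiv hM.am t)))
        rw [LinearIsometryEquiv.apply_symm_apply, LinearIsometryEquiv.symm_apply_apply]
        exact (hM.toSection_act f t).symm
      intertwines := fun g (s : hM.bundle.Section0) => by
        obtain ⟨t, rfl⟩ := (hM.sectionEquiv hM.am).surjective s
        refine (hM.sectionEquiv hM.am).injective ?_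
        change hM.sectionEquiv hM.am ((hM.sectionEquiv hM.am).symm
          (hM.dynBundle.koop g (hM.sectionEquiv hM.am t))) = hM.sectionEquiv hM.am
          (M.op g ((hM.sectionEquiv hM.am).symm (hM.sectionEquiv hM.am t)))
        rw [LinearIsometryEquiv.symm_apply_apply]
        refine ((hM.sectionEquiv hM.am).apply_symm_apply _).trans ?_
        exact (hM.toSection_op g t).symm }
  inv :=
    { toCLM := ((hM.sectionEquiv hM.am).toContinuousLinearEquiv :
        M.carrier →L[𝕜] hM.bundle.Section0)
      map_act := hM.toSection_act
      intertwines := hM.toSection_op }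
  hom_inv_id := PreDynModule.Hom.ext (ContinuousLinearMap.ext
    (hM.sectionEquiv hM.am).apply_symm_apply)
  inv_hom_id := PreDynModule.Hom.ext (ContinuousLinearMap.ext
    (hM.sectionEquiv hM.am).symm_apply_apply)

end PreDynModule

end Reconstruction

/-- Fibres are taken in the universe `max u v` because section spaces over Ω live there and the
reconstructed fibres are quotients of modules of that size. -/
theorem mainTheorem1 (𝕜 : Type k) [RCLike 𝕜]
    (Ω : Type u) [TopologicalSpace Ω] [T2Space Ω] [LocallyCompactSpace Ω]
    {G : Type w} [Group G] [TopologicalSpace G] [IsTopologicalGroup G] [T2Space G]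
    [LocallyCompactSpace G] [MulAction G Ω] [ContinuousSMul G Ω]
    (S : Submonoid G) (hS : IsClosed (S : Set G)) :
    ∃ h : ∀ E : DynBundle.{u, max u v} 𝕜 Ω S,
        dynAMModule.{u, max u v} 𝕜 Ω S ((sectionFunctor 𝕜 Ω S).obj E),
      ((dynAMModule.{u, max u v} 𝕜 Ω S).lift (sectionFunctor 𝕜 Ω S) h).EssSurj ∧
      ((dynAMModule.{u, max u v} 𝕜 Ω S).lift (sectionFunctor 𝕜 Ω S) h).Full ∧
      ((dynAMModule.{u, max u v} 𝕜 Ω S).lift (sectionFunctor 𝕜 Ω S) h).Faithful := by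
  -- Closedness of S supplies the compact neighbourhoods in S used in both continuity arguments.
  have : LocallyCompactSpace S := hS.isClosedEmbedding_subtypeVal.locallyCompactSpace
  have h : ∀ E : DynBundle.{u, max u v} 𝕜 Ω S,
      dynAMModule.{u, max u v} 𝕜 Ω S ((sectionFunctor 𝕜 Ω S).obj E) :=
    fun E => isDynAMModule_sectionFunctor E
  -- Composed with the fully faithful inclusion, the lift is `sectionFunctor`, so fullness and
  -- faithfulness descend to it.
  have hiso := (dynAMModule.{u, max u v} 𝕜 Ω S).liftCompιIso
    (sectionFunctor.{u, max u v} 𝕜 Ω S) h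
  refine ⟨h, ⟨fun M => ?_⟩, ?_, ?_⟩
  · have hM : M.obj.IsDynAMModule := M.property
    exact ⟨hM.dynBundle, ⟨(dynAMModule.{u, max u v} 𝕜 Ω S).isoMk hM.iso⟩⟩
  · exact Functor.Full.of_comp_faithful_iso hiso
  · exact Functor.Faithful.of_comp_iso hiso
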